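/- For an $n\times n$ complex matrix $A$ let $F(A)=\{\langle Ax,x\rangle : x\in\mathbb{C}^n,\ \|x\|=1\}$ be its numerical range, where $\langle\cdot,\cdot\rangle$ is the standard scalar product on $\mathbb{C}^n$. A flat portion on the boundary $\partial F(A)$ is a maximal (with respect to inclusion) nondegenerate closed line segment contained in $\partial F(A)$. The matrix $A$ is called unitarily reducible if it is unitarily similar to a direct sum $B\oplus C$ of two square blocks, each of size at least one. Theorem. Let $A$ be a $5\times 5$ complex matrix that is nilpotent and unitarily reducible. Then there are at most two flat portions on $\partial F(A)$. Moreover, for each $N\in\{0,1,2\}$ there is a nilpotent, unitarily reducible $5\times 5$ complex matrix $A$ such that $\partial F(A)$ has exactly $N$ flat portions. -/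

import Mathlib

/-- The numerical range `F(A) = {⟨Ax, x⟩ : x ∈ ℂⁿ, ‖x‖ = 1}` of an `n`-by-`n` complex matrix, for the
standard scalar product on `ℂⁿ` (Mathlib's `inner ℂ x y` is linear in its second argument `y`). -/
def numericalRange {n : ℕ} (A : Matrix (Fin n) (Fin n) ℂ) : Set ℂ :=
  {z | ∃ x : EuclideanSpace ℂ (Fin n), ‖x‖ = 1 ∧ z = inner ℂ x (Matrix.toEuclideanLin A x)}

/-- `A` is unitarily reducible: it is unitarily similar to a direct sum of two square blocks,
each of size at least one. -/
def IsUnitarilyReducible {n : ℕ} (A : Matrix (Fin n) (Fin n) ℂ) : Prop :=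
  ∃ (k m : ℕ) (e : Fin k ⊕ Fin m ≃ Fin n) (U : Matrix.unitaryGroup (Fin n) ℂ)
    (B : Matrix (Fin k) (Fin k) ℂ) (C : Matrix (Fin m) (Fin m) ℂ),
    0 < k ∧ 0 < m ∧
      star (U : Matrix (Fin n) (Fin n) ℂ) * A * (U : Matrix (Fin n) (Fin n) ℂ) =
        Matrix.reindex e e (Matrix.fromBlocks B 0 0 C)

/-- `S` is a nondegenerate closed line segment lying on the boundary of `F`. -/
def IsBoundarySegment (F S : Set ℂ) : Prop :=
  S ⊆ frontier F ∧ ∃ a b : ℂ, a ≠ b ∧ S = segment ℝ a b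

/-- The flat portions on the boundary of `F`: the nondegenerate closed line segments on the
boundary that are not properly contained in a longer one. -/
def flatPortions (F : Set ℂ) : Set (Set ℂ) :=
  {S | IsBoundarySegment F S ∧ ∀ T, IsBoundarySegment F T → S ⊆ T → T = S}

section

open Matrix ComplexConjugate
open scoped ComplexOrder

/-! The matrix `conj u • A + u • Aᴴ` has largest eigenvalue twice the support value of `F(A)` in the
unit direction `u`. A flat portion with outer normal `u` and support value `h` forces `2 * h` to be
a multiple largest eigenvalue: the pencil `2h - (conj u • A + u • Aᴴ)` is positive semidefinite with
at least two-dimensional kernel. Flat portions correspond to such directions `u`, so the upper bound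
says that three distinct ones cannot coexist. By Schur triangularization the blocks may be taken
strictly upper triangular; then `h > 0`, and the block sizes are 1 + 4 or 2 + 3.

Two facts about the plane carry the argument: three supporting lines that contain nondegenerate
faces are not concurrent (`not_concurrent`), and a nonzero number cannot have equal real parts after
multiplication by three distinct unimodular numbers (`eq_zero_of_re_conj_mul_eq`).

Blocks 1 + 4: the zero block is harmless because `2 * h > 0`, so the double kernel sits in the 4 × 4
block, and all its 3 × 3 principal minors vanish. Each minor is a cubic `t³ - n t - 2 Re (conj u *
τ)` at `t = 2h`; the difference of two cubics with different `n` would put all three supporting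
lines through one point, so all `n` and all `τ` agree (`coeff_eq_of_three_flatDirections`). This
rigidity leaves two possibilities. If `τ = 0`, either the range is a disc or `u²` is determined,
which allows two directions only. If `τ ≠ 0`, the quartic determinant splits into two quadratics,
and a double largest root pins down `Re (conj u * τ)`, which contradicts the second plane fact.

Blocks 2 + 3: a double kernel inside the 3 × 3 block determines `u` and excludes every other flat
direction. Otherwise both blocks are singular, the 2 × 2 block fixes `h`, the 3 × 3 block then fixes
`Re (conj u * τ)`, so `τ = 0` and the range is a disc.

Explicit matrices attain the values 0, 1 and 2. -/

/-- The numerical range of a square matrix with rows and columns indexed by a finite type. -/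
def fieldOfValues {ι : Type*} [Fintype ι] (M : Matrix ι ι ℂ) : Set ℂ :=
  {z | ∃ x : ι → ℂ, star x ⬝ᵥ x = 1 ∧ z = star x ⬝ᵥ (M *ᵥ x)}

theorem numericalRange_eq_fieldOfValues {n : ℕ} (A : Matrix (Fin n) (Fin n) ℂ) :
    numericalRange A = fieldOfValues A := by
  have key : ∀ x : EuclideanSpace ℂ (Fin n), ‖x‖ = 1 ↔ star x.ofLp ⬝ᵥ x.ofLp = 1 := by
    intro x
    have h : star x.ofLp ⬝ᵥ x.ofLp = ((‖x‖ ^ 2 : ℝ) : ℂ) := by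
      rw [dotProduct_comm, ← EuclideanSpace.inner_eq_star_dotProduct, inner_self_eq_norm_sq_to_K]
      norm_cast
    rw [h]
    norm_cast
    exact (pow_eq_one_iff_of_nonneg (norm_nonneg x) two_ne_zero).symm
  ext z
  constructor
  · rintro ⟨x, hx, rfl⟩
    refine ⟨x.ofLp, (key x).1 hx, ?_⟩
    rw [EuclideanSpace.inner_eq_star_dotProduct, dotProduct_comm]
    rfl
  · rintro ⟨x, hx, rfl⟩
    refine ⟨WithLp.toLp 2 x, (key _).2 hx, ?_⟩
    rw [EuclideanSpace.inner_eq_star_dotProduct, dotProduct_comm]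
    rfl

/-! ### Unitary invariance, compactness and convexity of the numerical range -/

section

variable {ι κ : Type*} [Fintype ι] [Fintype κ]

theorem fieldOfValues_conj_subset [DecidableEq ι] (M U : Matrix ι ι ℂ) (hU : star U * U = 1) :
    fieldOfValues (star U * M * U) ⊆ fieldOfValues M := by
  rintro z ⟨x, hx, rfl⟩
  refine ⟨U *ᵥ x, ?_, ?_⟩
  · rw [star_mulVec, ← dotProduct_mulVec, mulVec_mulVec, ← star_eq_conjTranspose, hU, one_mulVec, hx]
  · rw [star_mulVec, ← dotProduct_mulVec, mulVec_mulVec, mulVec_mulVec, ← star_eq_conjTranspose]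

theorem fieldOfValues_unitary_conj [DecidableEq ι] (M : Matrix ι ι ℂ) (U : unitaryGroup ι ℂ) :
    fieldOfValues (star (U : Matrix ι ι ℂ) * M * (U : Matrix ι ι ℂ)) = fieldOfValues M := by
  have h1 := Unitary.coe_star_mul_self U
  have h2 : (U : Matrix ι ι ℂ) * star (U : Matrix ι ι ℂ) = 1 := Unitary.coe_mul_star_self U
  refine (fieldOfValues_conj_subset M U h1).antisymm ?_
  have h := fieldOfValues_conj_subset (star (U : Matrix ι ι ℂ) * M * (U : Matrix ι ι ℂ))
    (star (U : Matrix ι ι ℂ)) (by rw [star_star, h2])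
  rwa [star_star, Matrix.mul_assoc, Matrix.mul_assoc, Matrix.mul_assoc, h2, Matrix.mul_one,
    ← Matrix.mul_assoc, h2, Matrix.one_mul] at h

theorem fieldOfValues_reindex_subset (e : ι ≃ κ) (M : Matrix ι ι ℂ) :
    fieldOfValues (reindex e e M) ⊆ fieldOfValues M := by
  rintro z ⟨x, hx, rfl⟩
  refine ⟨x ∘ e, ?_, ?_⟩
  · rw [← hx]
    simp only [dotProduct, Function.comp_apply, Pi.star_apply]
    exact e.sum_comp fun i => star (x i) * x i
  · simp only [dotProduct, mulVec, Function.comp_apply, Pi.star_apply, reindex_apply,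
      submatrix_apply]
    rw [← e.sum_comp]
    refine Finset.sum_congr rfl fun i _ => ?_
    rw [← e.sum_comp]
    simp

theorem fieldOfValues_reindex (e : ι ≃ κ) (M : Matrix ι ι ℂ) :
    fieldOfValues (reindex e e M) = fieldOfValues M := by
  refine (fieldOfValues_reindex_subset e M).antisymm ?_
  have h := fieldOfValues_reindex_subset e.symm (reindex e e M)
  simpa using h

theorem star_dotProduct_self_eq (x : ι → ℂ) : star x ⬝ᵥ x = ((∑ i, ‖x i‖ ^ 2 : ℝ) : ℂ) := by
  simp [dotProduct, Complex.conj_mul']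

theorem sum_norm_sq_pos {x : ι → ℂ} (hx : x ≠ 0) : 0 < ∑ i, ‖x i‖ ^ 2 := by
  obtain ⟨i, hi⟩ := Function.ne_iff.1 hx
  exact Finset.sum_pos' (fun _ _ => sq_nonneg _)
    ⟨i, Finset.mem_univ i, pow_pos (norm_pos_iff.2 hi) 2⟩

theorem isCompact_fieldOfValues (M : Matrix ι ι ℂ) : IsCompact (fieldOfValues M) := by
  have hS : IsCompact {x : ι → ℂ | star x ⬝ᵥ x = 1} := by
    refine Metric.isCompact_of_isClosed_isBounded ?_ ?_
    · exact isClosed_eq (by fun_prop) continuous_const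
    · refine (Metric.isBounded_closedBall (x := (0 : ι → ℂ)) (r := 1)).subset ?_
      intro x hx
      rw [Set.mem_ofPred_eq, star_dotProduct_self_eq] at hx
      have hx' : ∑ i, ‖x i‖ ^ 2 = 1 := by exact_mod_cast hx
      rw [mem_closedBall_zero_iff, pi_norm_le_iff_of_nonneg zero_le_one]
      intro i
      have := Finset.single_le_sum (f := fun i => ‖x i‖ ^ 2) (fun i _ => sq_nonneg _)
        (Finset.mem_univ i)
      rw [hx'] at this
      exact (sq_le_one_iff₀ (norm_nonneg _)).1 this
  have : fieldOfValues M = (fun x => star x ⬝ᵥ (M *ᵥ x)) '' {x : ι → ℂ | star x ⬝ᵥ x = 1} := by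
    ext z
    constructor
    · rintro ⟨x, hx, rfl⟩
      exact ⟨x, hx, rfl⟩
    · rintro ⟨x, hx, rfl⟩
      exact ⟨x, hx, rfl⟩
  rw [this]
  exact hS.image (by fun_prop)

theorem div_mem_fieldOfValues (M : Matrix ι ι ℂ) {x : ι → ℂ} (hx : x ≠ 0) :
    (star x ⬝ᵥ (M *ᵥ x)) / (star x ⬝ᵥ x) ∈ fieldOfValues M := by
  set N : ℝ := ∑ i, ‖x i‖ ^ 2 with hN
  have hxN := star_dotProduct_self_eq x
  rw [← hN] at hxN
  have hN0 : 0 < N := sum_norm_sq_pos hx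
  have hs : ((Real.sqrt N : ℝ) : ℂ) * (Real.sqrt N : ℝ) = N := by
    rw [← Complex.ofReal_mul, Real.mul_self_sqrt hN0.le]
  have hs0 : ((Real.sqrt N : ℝ) : ℂ) ≠ 0 := by
    exact_mod_cast (Real.sqrt_pos.2 hN0).ne'
  have hst : star (((Real.sqrt N : ℝ) : ℂ)⁻¹) = ((Real.sqrt N : ℝ) : ℂ)⁻¹ := by
    rw [← Complex.ofReal_inv]
    exact Complex.conj_ofReal _
  refine ⟨((Real.sqrt N : ℝ) : ℂ)⁻¹ • x, ?_, ?_⟩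
  · rw [star_smul, smul_dotProduct, dotProduct_smul, hxN, ← hs, hst, smul_eq_mul, smul_eq_mul]
    field_simp
  · rw [star_smul, smul_dotProduct, mulVec_smul, dotProduct_smul, hxN, ← hs, hst, smul_eq_mul,
      smul_eq_mul]
    field_simp

theorem affine_mem_fieldOfValues [DecidableEq ι] {M : Matrix ι ι ℂ} {z : ℂ}
    (hz : z ∈ fieldOfValues M) (α β : ℂ) : α * z + β ∈ fieldOfValues (α • M + β • 1) := by
  obtain ⟨x, hx, rfl⟩ := hz
  refine ⟨x, hx, ?_⟩
  rw [add_mulVec, smul_mulVec, smul_mulVec, one_mulVec, dotProduct_add, dotProduct_smul,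
    dotProduct_smul, hx, smul_eq_mul, smul_eq_mul, mul_one]

/-- Rotating `y` by a suitable phase `c` makes the cross term real. The quadratic form is then real
along the path from `x` to `c • y`, and the intermediate value theorem applies to the normalized
form. -/
theorem ofReal_mem_fieldOfValues {M : Matrix ι ι ℂ} (h0 : 0 ∈ fieldOfValues M)
    (h1 : 1 ∈ fieldOfValues M) {t : ℝ} (ht : t ∈ Set.Icc (0 : ℝ) 1) :
    (t : ℂ) ∈ fieldOfValues M := by
  obtain ⟨x, hx, hx0⟩ := h0
  obtain ⟨y, hy, hy1⟩ := h1
  obtain ⟨c, hc, hcr⟩ : ∃ c : ℂ, conj c * c = 1 ∧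
      (c * (star x ⬝ᵥ (M *ᵥ y)) + conj c * (star y ⬝ᵥ (M *ᵥ x))).im = 0 := by
    set g := star x ⬝ᵥ (M *ᵥ y)
    set k := star y ⬝ᵥ (M *ᵥ x)
    by_cases h : g - conj k = 0
    · refine ⟨1, by simp, ?_⟩
      rw [sub_eq_zero.1 h]
      simp
    · refine ⟨conj (g - conj k) / ‖g - conj k‖, ?_, ?_⟩
      · have hn : (‖g - conj k‖ : ℂ) ≠ 0 := by exact_mod_cast norm_ne_zero_iff.2 h
        rw [map_div₀, Complex.conj_ofReal, Complex.conj_conj, div_mul_div_comm, Complex.mul_conj']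
        field_simp
      · have : ∀ c : ℂ, (c * g + conj c * k).im = (c * (g - conj k)).im := by
          intro c
          simp only [Complex.add_im, Complex.mul_im, Complex.sub_im, Complex.sub_re,
            Complex.conj_re, Complex.conj_im]
          ring
        rw [this, div_mul_eq_mul_div, Complex.conj_mul', ← Complex.ofReal_pow,
          ← Complex.ofReal_div, Complex.ofReal_im]
  set m := c * (star x ⬝ᵥ (M *ᵥ y)) + conj c * (star y ⬝ᵥ (M *ᵥ x)) with hm
  let v : ℝ → ι → ℂ := fun s => ((1 - s : ℝ) : ℂ) • x + ((s : ℂ) * c) • y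
  have hq : ∀ s : ℝ, star (v s) ⬝ᵥ (M *ᵥ v s) = ((s ^ 2 + s * (1 - s) * m.re : ℝ) : ℂ) := by
    intro s
    have hmre : (m.re : ℂ) = m := Complex.ext (by simp) (by simp [hcr])
    push_cast
    rw [hmre, hm]
    simp only [v, mulVec_add, mulVec_smul, star_add, star_smul, add_dotProduct, dotProduct_add,
      smul_dotProduct, dotProduct_smul, ← hx0, ← hy1, smul_eq_mul, star_mul']
    simp only [RCLike.star_def, Complex.conj_ofReal]
    push_cast
    linear_combination (s : ℂ) ^ 2 * hc
  -- If `v s = 0`, the form evaluated on both sides of `(1 - s) x = -s c y` gives `0 = s²`; then `s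
  -- = 0` and `x = 0`.
  have hv : ∀ s, v s ≠ 0 := by
    intro s hs
    have e : ((1 - s : ℝ) : ℂ) • x = -(((s : ℂ) * c) • y) := eq_neg_of_add_eq_zero_left hs
    have e1 : star (((1 - s : ℝ) : ℂ) • x) ⬝ᵥ (M *ᵥ (((1 - s : ℝ) : ℂ) • x))
        = star (-(((s : ℂ) * c) • y)) ⬝ᵥ (M *ᵥ (-(((s : ℂ) * c) • y))) := by rw [e]
    simp only [mulVec_smul, mulVec_neg, star_neg, star_smul, smul_dotProduct, dotProduct_smul,
      neg_dotProduct, dotProduct_neg, ← hx0, ← hy1, smul_eq_mul, star_mul'] at e1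
    simp only [RCLike.star_def, Complex.conj_ofReal] at e1
    have e2 : (s : ℂ) ^ 2 = 0 := by linear_combination -e1 - (s : ℂ) ^ 2 * hc
    have e3 : s = 0 := by exact_mod_cast pow_eq_zero_iff (two_ne_zero) |>.1 e2
    rw [e3] at e
    simp only [sub_zero, Complex.ofReal_one, one_smul, Complex.ofReal_zero, zero_mul, zero_smul,
      neg_zero] at e
    rw [e] at hx
    simp at hx
  have hN : ∀ s, 0 < ∑ i, ‖v s i‖ ^ 2 := fun s => sum_norm_sq_pos (hv s)
  let f : ℝ → ℝ := fun s => (s ^ 2 + s * (1 - s) * m.re) / ∑ i, ‖v s i‖ ^ 2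
  have hf : ContinuousOn f (Set.Icc 0 1) := by
    refine ContinuousOn.div (by fun_prop) ?_ fun s _ => (hN s).ne'
    simp only [v, Pi.add_apply, Pi.smul_apply, smul_eq_mul]
    fun_prop
  have hf0 : f 0 = 0 := by simp [f]
  have hf1 : f 1 = 1 := by
    have : ∑ i, ‖v 1 i‖ ^ 2 = 1 := by
      have h' := star_dotProduct_self_eq (v 1)
      have h2 : star (v 1) ⬝ᵥ v 1 = 1 := by
        simp only [v, sub_self, Complex.ofReal_zero, zero_smul, zero_add, Complex.ofReal_one,
          one_mul, star_smul, smul_dotProduct, dotProduct_smul, hy, smul_eq_mul, mul_one]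
        exact (mul_comm _ _).trans hc
      rw [h2] at h'
      exact_mod_cast h'.symm
    simp [f, this]
  obtain ⟨s, -, hs⟩ : t ∈ f '' Set.Icc 0 1 :=
    intermediate_value_Icc zero_le_one hf (by rwa [hf0, hf1])
  have := div_mem_fieldOfValues M (hv s)
  rw [hq, star_dotProduct_self_eq, ← Complex.ofReal_div] at this
  rwa [← hs]

/-- The **Toeplitz–Hausdorff theorem**. -/
theorem convex_fieldOfValues (M : Matrix ι ι ℂ) : Convex ℝ (fieldOfValues M) := by
  classical
  rw [convex_iff_segment_subset]
  intro a ha b hb z hz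
  rcases eq_or_ne a b with rfl | hab
  · rw [segment_same] at hz
    rwa [Set.mem_singleton_iff.1 hz]
  rw [segment_eq_image'] at hz
  obtain ⟨t, ht, rfl⟩ := hz
  have hd : b - a ≠ 0 := sub_ne_zero.2 hab.symm
  set M' := (b - a)⁻¹ • M + (-(b - a)⁻¹ * a) • (1 : Matrix ι ι ℂ) with hM'
  have h0 : (0 : ℂ) ∈ fieldOfValues M' := by
    convert affine_mem_fieldOfValues ha (b - a)⁻¹ (-(b - a)⁻¹ * a) using 1
    ring
  have h1 : (1 : ℂ) ∈ fieldOfValues M' := by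
    convert affine_mem_fieldOfValues hb (b - a)⁻¹ (-(b - a)⁻¹ * a) using 1
    field_simp
    ring
  have h := affine_mem_fieldOfValues (ofReal_mem_fieldOfValues h0 h1 ht) (b - a) a
  have hMM : (b - a) • M' + a • (1 : Matrix ι ι ℂ) = M := by
    rw [hM', smul_add, smul_smul, smul_smul, mul_inv_cancel₀ hd, one_smul, add_assoc, ← add_smul]
    have : (b - a) * (-(b - a)⁻¹ * a) + a = 0 := by
      field_simp
      ring
    rw [this, zero_smul, add_zero]
  rw [hMM] at h
  convert h using 1
  simp only [Complex.real_smul]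
  ring

end

/-! ### Flat portions as faces on supporting lines -/

/-- `u` is the outer unit normal of a nondegenerate face of `F`, and `h` is the value at `u` of the
support function of `F`. -/
structure IsFlatDirection (F : Set ℂ) (u : ℂ) (h : ℝ) : Prop where
  unit : conj u * u = 1
  le : ∀ z ∈ F, (conj u * z).re ≤ h
  nondeg : ∃ a ∈ F, ∃ b ∈ F, a ≠ b ∧ (conj u * a).re = h ∧ (conj u * b).re = h

/-- The points of `F` on the line `Re (conj u * z) = h`. -/
def supportFace (F : Set ℂ) (u : ℂ) (h : ℝ) : Set ℂ := {z ∈ F | (conj u * z).re = h}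

theorem exists_unit_re_le_of_notMem {F : Set ℂ} (hF : IsClosed F) (hc : Convex ℝ F) {x : ℂ}
    (hx : x ∉ F) : ∃ u : ℂ, ‖u‖ = 1 ∧ ∀ z ∈ F, (conj u * z).re ≤ (conj u * x).re := by
  rcases F.eq_empty_or_nonempty with rfl | ⟨z₀, hz₀⟩
  · exact ⟨1, by simp, by simp⟩
  obtain ⟨f, c, hfc, hcx⟩ := geometric_hahn_banach_closed_point hc hF hx
  set w : ℂ := ⟨f 1, f Complex.I⟩ with hw
  have hf : ∀ z, f z = (conj w * z).re := by
    intro z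
    have : z = z.re • (1 : ℂ) + z.im • Complex.I := by
      simp [Complex.real_smul]
    rw [this, map_add, map_smul, map_smul]
    simp [hw]
    ring
  have hw0 : w ≠ 0 := by
    intro h
    have h1 := (hfc z₀ hz₀).trans hcx
    rw [hf, hf, h] at h1
    simp at h1
  have hn : 0 < ‖w‖ := norm_pos_iff.2 hw0
  refine ⟨(‖w‖⁻¹ : ℝ) * w, ?_, fun z hz => ?_⟩
  · rw [norm_mul, Complex.norm_real, norm_inv, norm_norm, inv_mul_cancel₀ hn.ne']
  · have h1 := (hfc z hz).trans hcx
    rw [hf, hf] at h1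
    rw [map_mul, Complex.conj_ofReal, mul_assoc, mul_assoc, Complex.re_ofReal_mul,
      Complex.re_ofReal_mul]
    exact mul_le_mul_of_nonneg_left h1.le (inv_nonneg.2 hn.le)

/-- A supporting line at a frontier point of a closed convex set. -/
theorem exists_unit_re_le_of_mem_frontier {F : Set ℂ} (hF : IsClosed F) (hc : Convex ℝ F) {m : ℂ}
    (hm : m ∈ frontier F) : ∃ u : ℂ, ‖u‖ = 1 ∧ ∀ z ∈ F, (conj u * z).re ≤ (conj u * m).re := by
  rw [frontier_eq_closure_inter_closure] at hm
  obtain ⟨x, hx, hxm⟩ := mem_closure_iff_seq_limit.1 hm.2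
  -- Points outside `F` that converge to `m` have separating unit normals; a limit normal exists by
  -- compactness of the circle.
  choose u hu hle using fun n => exists_unit_re_le_of_notMem hF hc (hx n)
  obtain ⟨v, hv, φ, hφ, hlim⟩ := (isCompact_sphere (0 : ℂ) 1).tendsto_subseq
    (x := u) (fun n => by simp [hu n])
  refine ⟨v, by simpa using hv, fun z hz => ?_⟩
  have hcu : Filter.Tendsto (fun n => conj (u (φ n))) Filter.atTop (nhds (conj v)) :=
    (Complex.continuous_conj.tendsto v).comp hlim
  refine le_of_tendsto_of_tendsto'
    ((Complex.continuous_re.tendsto _).comp (hcu.mul_const z))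
    ((Complex.continuous_re.tendsto _).comp (hcu.mul (hxm.comp hφ.tendsto_atTop)))
    fun n => hle (φ n) z hz

theorem conj_mul_self_of_norm {u : ℂ} (hu : ‖u‖ = 1) : conj u * u = 1 := by
  rw [Complex.conj_mul', hu]
  simp

theorem norm_of_conj_mul_self {u : ℂ} (hu : conj u * u = 1) : ‖u‖ = 1 := by
  rw [Complex.conj_mul'] at hu
  exact (pow_eq_one_iff_of_nonneg (norm_nonneg u) two_ne_zero).1 (by exact_mod_cast hu)

theorem supportFace_subset_frontier {F : Set ℂ} {u : ℂ} {h : ℝ} (hu : conj u * u = 1)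
    (hle : ∀ z ∈ F, (conj u * z).re ≤ h) : supportFace F u h ⊆ frontier F := by
  rintro z ⟨hz, hzh⟩
  refine ⟨subset_closure hz, fun hi => ?_⟩
  obtain ⟨ε, hε, hb⟩ := Metric.mem_nhds_iff.1 (mem_interior_iff_mem_nhds.1 hi)
  have hmem : z + ((ε / 2 : ℝ) : ℂ) * u ∈ F := by
    apply hb
    rw [Metric.mem_ball, dist_eq_norm, add_sub_cancel_left, norm_mul, Complex.norm_real,
      norm_of_conj_mul_self hu, Real.norm_eq_abs, abs_of_pos (by positivity)]
    linarith
  have h1 := hle _ hmem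
  have h2 : conj u * (z + ((ε / 2 : ℝ) : ℂ) * u) = conj u * z + ((ε / 2 : ℝ) : ℂ) := by
    linear_combination ((ε / 2 : ℝ) : ℂ) * hu
  rw [h2, Complex.add_re, Complex.ofReal_re, hzh] at h1
  linarith

theorem re_lineMap {u a b : ℂ} (t : ℝ) : (conj u * (a + t • (b - a))).re =
    (conj u * a).re + t * ((conj u * b).re - (conj u * a).re) := by
  rw [Complex.real_smul, mul_add, mul_left_comm, Complex.add_re, Complex.re_ofReal_mul, mul_sub,
    Complex.sub_re]

theorem convex_supportFace {F : Set ℂ} (hc : Convex ℝ F) (u : ℂ) (h : ℝ) :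
    Convex ℝ (supportFace F u h) := by
  rw [convex_iff_segment_subset]
  rintro a ⟨ha, hah⟩ b ⟨hb, hbh⟩ z hz
  refine ⟨hc.segment_subset ha hb hz, ?_⟩
  rw [segment_eq_image'] at hz
  obtain ⟨t, -, rfl⟩ := hz
  rw [re_lineMap, hah, hbh]
  ring

/-- The face is compact, convex and contained in a line, on which `Im (conj u * z)` is a coordinate;
its image is a closed interval. -/
theorem IsFlatDirection.isBoundarySegment {F : Set ℂ} (hF : IsCompact F) (hc : Convex ℝ F) {u : ℂ}
    {h : ℝ} (hd : IsFlatDirection F u h) : IsBoundarySegment F (supportFace F u h) := by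
  refine ⟨supportFace_subset_frontier hd.unit hd.le, ?_⟩
  obtain ⟨a, ha, b, hb, hab, hah, hbh⟩ := hd.nondeg
  have haS : a ∈ supportFace F u h := ⟨ha, hah⟩
  have hbS : b ∈ supportFace F u h := ⟨hb, hbh⟩
  have hcl : IsClosed {z : ℂ | (conj u * z).re = h} :=
    isClosed_eq (by fun_prop) continuous_const
  have hcomp : IsCompact (supportFace F u h) := hF.inter_right hcl
  have hconn : IsConnected (supportFace F u h) :=
    ⟨⟨a, haS⟩, (convex_supportFace hc u h).isPreconnected⟩
  have hcont : Continuous fun z : ℂ => (conj u * z).im := by fun_prop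
  have hI := eq_Icc_of_connected_compact (hconn.image _ hcont.continuousOn)
    (hcomp.image hcont)
  set I := (fun z : ℂ => (conj u * z).im) '' supportFace F u h with hIdef
  have hback : ∀ z ∈ supportFace F u h, z = u * ⟨h, (conj u * z).im⟩ := by
    intro z hz
    have : (⟨h, (conj u * z).im⟩ : ℂ) = conj u * z := Complex.ext hz.2.symm rfl
    rw [this]
    linear_combination -z * hd.unit
  have hne : I.Nonempty := ⟨_, a, haS, rfl⟩
  have hIc : IsCompact I := hcomp.image hcont
  have hlu : sInf I ≤ sSup I := csInf_le_csSup hne hIc.bddBelow hIc.bddAbove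
  obtain ⟨p, hp, hpI⟩ := hIc.sInf_mem hne
  obtain ⟨q, hq, hqI⟩ := hIc.sSup_mem hne
  simp only at hpI hqI
  have hsub : supportFace F u h ⊆ segment ℝ p q := by
    intro z hz
    have hzI : (conj u * z).im ∈ Set.Icc (sInf I) (sSup I) := by
      rw [← hI]
      exact ⟨z, hz, rfl⟩
    rw [← segment_eq_Icc hlu, segment_eq_image'] at hzI
    obtain ⟨t, ht, htz⟩ := hzI
    rw [segment_eq_image']
    refine ⟨t, ht, ?_⟩
    rw [hback z hz, hback p hp, hback q hq, ← htz, hpI, hqI]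
    simp only [Complex.real_smul, smul_eq_mul]
    have : (⟨h, sInf I + t * (sSup I - sInf I)⟩ : ℂ)
        = ⟨h, sInf I⟩ + (t : ℂ) * (⟨h, sSup I⟩ - ⟨h, sInf I⟩) := by
      apply Complex.ext <;> simp
    rw [this]
    ring
  refine ⟨p, q, ?_, hsub.antisymm ((convex_supportFace hc u h).segment_subset hp hq)⟩
  rintro rfl
  rw [segment_same] at hsub
  exact hab ((hsub haS).trans (hsub hbS).symm)

/-- A supporting line at the midpoint must contain both endpoints, so the segment lies in a face,
and maximality makes it the whole face. -/
theorem exists_isFlatDirection_of_mem_flatPortions {F : Set ℂ} (hF : IsCompact F)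
    (hc : Convex ℝ F) {S : Set ℂ} (hS : S ∈ flatPortions F) :
    ∃ u h, IsFlatDirection F u h ∧ S = supportFace F u h := by
  obtain ⟨⟨hSF, a, b, hab, rfl⟩, hmax⟩ := hS
  have hm : a + (1 / 2 : ℝ) • (b - a) ∈ segment ℝ a b := by
    rw [segment_eq_image']
    exact ⟨1 / 2, by norm_num, rfl⟩
  obtain ⟨u, hu, hle⟩ := exists_unit_re_le_of_mem_frontier hF.isClosed hc (hSF hm)
  have ha := hF.isClosed.frontier_subset (hSF (left_mem_segment ℝ a b))
  have hb := hF.isClosed.frontier_subset (hSF (right_mem_segment ℝ a b))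
  have h1 := hle a ha
  have h2 := hle b hb
  have h3 := re_lineMap (u := u) (a := a) (b := b) (1 / 2)
  have hd : IsFlatDirection F u (conj u * (a + (1 / 2 : ℝ) • (b - a))).re :=
    ⟨conj_mul_self_of_norm hu, hle, a, ha, b, hb, hab, by linarith, by linarith⟩
  refine ⟨u, _, hd, (hmax _ (hd.isBoundarySegment hF hc) ?_).symm⟩
  exact (convex_supportFace hc _ _).segment_subset ⟨ha, by linarith⟩ ⟨hb, by linarith⟩

/-- A larger boundary segment shares two distinct points with the supporting line, hence lies on it.
-/
theorem IsFlatDirection.supportFace_mem_flatPortions {F : Set ℂ} (hF : IsCompact F)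
    (hc : Convex ℝ F) {u : ℂ} {h : ℝ} (hd : IsFlatDirection F u h) :
    supportFace F u h ∈ flatPortions F := by
  refine ⟨hd.isBoundarySegment hF hc, ?_⟩
  rintro T ⟨hTF, a, b, hab, rfl⟩ hsub
  refine Set.Subset.antisymm ?_ hsub
  obtain ⟨p, hp, q, hq, hpq, hph, hqh⟩ := hd.nondeg
  have hp' := hsub ⟨hp, hph⟩
  have hq' := hsub ⟨hq, hqh⟩
  rw [segment_eq_image'] at hp' hq'
  obtain ⟨s, -, rfl⟩ := hp'
  obtain ⟨t, -, rfl⟩ := hq'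
  simp only [re_lineMap] at hph hqh
  have hst : s ≠ t := by
    rintro rfl
    exact hpq rfl
  have hBA : (conj u * b).re - (conj u * a).re = 0 := by
    have : (s - t) * ((conj u * b).re - (conj u * a).re) = 0 := by linarith
    exact (mul_eq_zero.1 this).resolve_left (sub_ne_zero.2 hst)
  rw [hBA] at hph
  refine (convex_supportFace hc u h).segment_subset
    ⟨hF.isClosed.frontier_subset (hTF (left_mem_segment ℝ a b)), by linarith⟩
    ⟨hF.isClosed.frontier_subset (hTF (right_mem_segment ℝ a b)), by linarith⟩

theorem IsFlatDirection.supportValue_unique {F : Set ℂ} {u : ℂ} {h k : ℝ}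
    (hh : IsFlatDirection F u h) (hk : IsFlatDirection F u k) : h = k := by
  obtain ⟨a, ha, -, -, -, hah, -⟩ := hh.nondeg
  obtain ⟨b, hb, -, -, -, hbk, -⟩ := hk.nondeg
  have h1 := hk.le a ha
  have h2 := hh.le b hb
  linarith

theorem encard_flatPortions_le_two {F : Set ℂ} (hF : IsCompact F) (hc : Convex ℝ F)
    (H : ∀ u₁ u₂ u₃ : ℂ, ∀ h₁ h₂ h₃ : ℝ, IsFlatDirection F u₁ h₁ → IsFlatDirection F u₂ h₂ →
      IsFlatDirection F u₃ h₃ → u₁ ≠ u₂ → u₁ ≠ u₃ → u₂ ≠ u₃ → False) :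
    (flatPortions F).encard ≤ 2 := by
  by_contra hlt
  have h3 : (3 : ℕ∞) ≤ (flatPortions F).encard := by
    rw [not_le] at hlt
    exact Order.add_one_le_of_lt hlt
  obtain ⟨t, htF, ht⟩ := Set.exists_subset_encard_eq h3
  obtain ⟨x, y, z, hxy, hxz, hyz, rfl⟩ := Set.encard_eq_three.1 ht
  obtain ⟨u₁, h₁, d₁, rfl⟩ := exists_isFlatDirection_of_mem_flatPortions hF hc
    (htF (by simp : x ∈ _))
  obtain ⟨u₂, h₂, d₂, rfl⟩ := exists_isFlatDirection_of_mem_flatPortions hF hc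
    (htF (by simp : y ∈ _))
  obtain ⟨u₃, h₃, d₃, rfl⟩ := exists_isFlatDirection_of_mem_flatPortions hF hc
    (htF (by simp : z ∈ _))
  refine H u₁ u₂ u₃ h₁ h₂ h₃ d₁ d₂ d₃ ?_ ?_ ?_
  · rintro rfl
    exact hxy (by rw [d₁.supportValue_unique d₂])
  · rintro rfl
    exact hxz (by rw [d₁.supportValue_unique d₃])
  · rintro rfl
    exact hyz (by rw [d₂.supportValue_unique d₃])

/-! ### Plane geometry of three unit normals -/

theorem eq_or_eq_neg_of_im_conj_mul_eq_zero {u v : ℂ} (hu : conj u * u = 1) (hv : conj v * v = 1)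
    (h : (conj u * v).im = 0) : v = u ∨ v = -u := by
  obtain ⟨r, hr⟩ : ∃ r : ℝ, conj u * v = r := ⟨(conj u * v).re, Complex.ext (by simp) (by simp [h])⟩
  have hvu : v = r * u := by linear_combination u * hr - v * hu
  have hvr : conj v = r * conj u := by rw [hvu, map_mul, Complex.conj_ofReal]
  rw [hvr] at hv
  have h2 : (r : ℂ) ^ 2 = 1 := by linear_combination hv - r * hr
  rcases eq_or_eq_neg_of_sq_eq_sq (r : ℂ) 1 (by rw [h2, one_pow]) with h3 | h3
  · exact Or.inl (by rw [hvu, h3, one_mul])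
  · exact Or.inr (by rw [hvu, h3, neg_one_mul])

/-- Three supporting lines through one point cannot all contain a nondegenerate face. -/
theorem not_concurrent {F : Set ℂ} {u₁ u₂ u₃ : ℂ} {h₁ h₂ h₃ : ℝ}
    (d₁ : IsFlatDirection F u₁ h₁) (d₂ : IsFlatDirection F u₂ h₂) (d₃ : IsFlatDirection F u₃ h₃)
    (h₁₂ : u₁ ≠ u₂) (h₁₃ : u₁ ≠ u₃) (h₂₃ : u₂ ≠ u₃) (w : ℂ) (hw₁ : (conj u₁ * w).re = h₁)
    (hw₂ : (conj u₂ * w).re = h₂) (hw₃ : (conj u₃ * w).re = h₃) : False := by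
  -- A face point other than `w` is `w + s * I * u` with `s ≠ 0`; at it, the supporting inequalities
  -- of the other lines become sign conditions on `s`.
  have key : ∀ u h, IsFlatDirection F u h → (conj u * w).re = h → ∃ s : ℝ, s ≠ 0 ∧
      ∀ v k, IsFlatDirection F v k → (conj v * w).re = k → s * (conj v * u).im ≥ 0 := by
    intro u h d hw
    obtain ⟨z, hzF, hzw, hzh⟩ : ∃ z ∈ F, z ≠ w ∧ (conj u * z).re = h := by
      obtain ⟨a, ha, b, hb, hab, hah, hbh⟩ := d.nondeg
      by_cases haw : a = w
      · exact ⟨b, hb, fun hbw => hab (haw.trans hbw.symm), hbh⟩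
      · exact ⟨a, ha, haw, hah⟩
    have hz : z = w + (conj u * (z - w)).im * Complex.I * u := by
      have : conj u * (z - w) = (conj u * (z - w)).im * Complex.I := by
        apply Complex.ext
        · rw [mul_sub, Complex.sub_re, hzh, hw]
          simp
        · simp
      rw [← this]
      linear_combination -(z - w) * d.unit
    refine ⟨(conj u * (z - w)).im, fun h0 => hzw (by rw [hz, h0]; simp), fun v k dv hv => ?_⟩
    have h1 := dv.le z hzF
    rw [hz, ← hv] at h1
    generalize (conj u * (z - w)).im = s at h1
    have h2 : (conj v * (w + (s : ℂ) * Complex.I * u)).re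
        = (conj v * w).re - s * (conj v * u).im := by
      simp only [Complex.mul_re, Complex.add_re, Complex.mul_im, Complex.ofReal_re, Complex.I_re,
        Complex.ofReal_im, Complex.I_im, Complex.add_im, Complex.conj_re, Complex.conj_im]
      ring
    rw [h2] at h1
    linarith
  have anti : ∀ u v : ℂ, (conj v * u).im = -(conj u * v).im := by
    intro u v
    simp only [Complex.mul_im, Complex.conj_re, Complex.conj_im]
    ring
  obtain ⟨s₁, hs₁, H₁⟩ := key _ _ d₁ hw₁
  obtain ⟨s₂, hs₂, H₂⟩ := key _ _ d₂ hw₂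
  obtain ⟨s₃, hs₃, H₃⟩ := key _ _ d₃ hw₃
  have a1 := H₁ _ _ d₂ hw₂
  have a2 := H₁ _ _ d₃ hw₃
  have a3 := H₂ _ _ d₁ hw₁
  have a4 := H₂ _ _ d₃ hw₃
  have a5 := H₃ _ _ d₁ hw₁
  have a6 := H₃ _ _ d₂ hw₂
  rw [anti] at a1 a2 a4
  have e12 := eq_or_eq_neg_of_im_conj_mul_eq_zero d₁.unit d₂.unit
  have e13 := eq_or_eq_neg_of_im_conj_mul_eq_zero d₁.unit d₃.unit
  have e23 := eq_or_eq_neg_of_im_conj_mul_eq_zero d₂.unit d₃.unit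
  -- Parallel distinct normals are antipodal; the sign conditions then make the third normal
  -- parallel too, hence equal to one of them.
  have D12 : (conj u₁ * u₂).im ≠ 0 := by
    intro h0
    have h2 := (e12 h0).resolve_left h₁₂.symm
    rw [h2, map_neg, neg_mul, Complex.neg_im] at a6
    have h3 : s₃ * (conj u₁ * u₃).im = 0 := by linarith
    rcases e13 ((mul_eq_zero.1 h3).resolve_left hs₃) with h | h
    · exact h₁₃ h.symm
    · exact h₂₃ (h2.trans h.symm)
  have D13 : (conj u₁ * u₃).im ≠ 0 := by
    intro h0
    have h2 := (e13 h0).resolve_left h₁₃.symm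
    rw [h2, mul_neg (conj u₂), Complex.neg_im, anti] at a4
    have h3 : s₂ * (conj u₁ * u₂).im = 0 := by linarith
    exact D12 ((mul_eq_zero.1 h3).resolve_left hs₂)
  have D23 : (conj u₂ * u₃).im ≠ 0 := by
    intro h0
    have h2 := (e23 h0).resolve_left h₂₃.symm
    rw [h2, mul_neg (conj u₁), Complex.neg_im] at a2
    have h3 : s₁ * (conj u₁ * u₂).im = 0 := by linarith
    exact D12 ((mul_eq_zero.1 h3).resolve_left hs₁)
  generalize (conj u₁ * u₂).im = x at *
  generalize (conj u₁ * u₃).im = y at *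
  generalize (conj u₂ * u₃).im = z at *
  -- With all three cross products nonzero, the signs around the three lines are inconsistent.
  rw [ge_iff_le, mul_nonneg_iff] at a1 a2 a3 a4 a5 a6
  grind

/-- The numbers `conj uᵢ * s` lie on a circle of radius `‖s‖` and on one vertical line, which share
at most two points. -/
theorem eq_zero_of_re_conj_mul_eq {u₁ u₂ u₃ s : ℂ} (hu₁ : conj u₁ * u₁ = 1)
    (hu₂ : conj u₂ * u₂ = 1) (hu₃ : conj u₃ * u₃ = 1) (h₁₂ : u₁ ≠ u₂) (h₁₃ : u₁ ≠ u₃)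
    (h₂₃ : u₂ ≠ u₃) (k : ℝ) (hk₁ : (conj u₁ * s).re = k) (hk₂ : (conj u₂ * s).re = k)
    (hk₃ : (conj u₃ * s).re = k) : s = 0 := by
  by_contra hs
  have hn : ∀ u : ℂ, conj u * u = 1 → (conj u * s).re = k → (conj u * s).im ^ 2 = ‖s‖ ^ 2 - k ^ 2 := by
    intro u hu hk
    have h1 : ‖conj u * s‖ = ‖s‖ := by
      rw [norm_mul, Complex.norm_conj, norm_of_conj_mul_self hu, one_mul]
    rw [← h1, ← Complex.normSq_eq_norm_sq, Complex.normSq_apply, hk]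
    ring
  have hinj : ∀ u v : ℂ, (conj u * s).re = k → (conj v * s).re = k →
      (conj u * s).im = (conj v * s).im → u = v := by
    intro u v hu hv h
    have : conj u * s = conj v * s := Complex.ext (hu.trans hv.symm) h
    exact (starRingEnd ℂ).injective (mul_right_cancel₀ hs this)
  have q12 := (hn _ hu₁ hk₁).trans (hn _ hu₂ hk₂).symm
  have q13 := (hn _ hu₁ hk₁).trans (hn _ hu₃ hk₃).symm
  rcases sq_eq_sq_iff_eq_or_eq_neg.1 q12 with h | h
  · exact h₁₂ (hinj _ _ hk₁ hk₂ h)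
  rcases sq_eq_sq_iff_eq_or_eq_neg.1 q13 with h' | h'
  · exact h₁₃ (hinj _ _ hk₁ hk₃ h')
  exact h₂₃ (hinj _ _ hk₂ hk₃ (by linarith))

/-- A tangent line of a disc meets the disc in a single point. -/
theorem not_isFlatDirection_of_norm_le {F : Set ℂ} {u : ℂ} {r : ℝ} (hF : ∀ z ∈ F, ‖z‖ ≤ r) :
    ¬ IsFlatDirection F u r := by
  intro d
  have key : ∀ z ∈ F, (conj u * z).re = r → z = r * u := by
    intro z hz hr
    have h1 : ‖conj u * z‖ ≤ r := by
      rw [norm_mul, Complex.norm_conj, norm_of_conj_mul_self d.unit, one_mul]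
      exact hF z hz
    have h2 : (conj u * z).im = 0 := by
      have h3 : ‖conj u * z‖ ^ 2 ≤ r ^ 2 := pow_le_pow_left₀ (norm_nonneg _) h1 2
      rw [← Complex.normSq_eq_norm_sq, Complex.normSq_apply, hr] at h3
      nlinarith
    have h4 : conj u * z = r := Complex.ext (by simp [hr]) (by simp [h2])
    linear_combination u * h4 - z * d.unit
  obtain ⟨a, ha, b, hb, hab, hah, hbh⟩ := d.nondeg
  exact hab ((key a ha hah).trans (key b hb hbh).symm)

/-! ### The Kippenhahn pencil, its kernel and the support function -/

section

variable {ι : Type*} [DecidableEq ι]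

/-- The matrix `t - 2 Re (conj u * M)`, where `Re` stands for the Hermitian part. -/
def kippenhahnPencil (M : Matrix ι ι ℂ) (u : ℂ) (t : ℝ) : Matrix ι ι ℂ :=
  (t : ℂ) • (1 : Matrix ι ι ℂ) - (conj u • M + u • Mᴴ)

theorem kippenhahnPencil_apply (M : Matrix ι ι ℂ) (u : ℂ) (t : ℝ) (i j : ι) :
    kippenhahnPencil M u t i j = (if i = j then (t : ℂ) else 0) - (conj u * M i j + u * conj (M j i)) := by
  simp [kippenhahnPencil, one_apply]

theorem isHermitian_kippenhahnPencil (M : Matrix ι ι ℂ) (u : ℂ) (t : ℝ) :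
    (kippenhahnPencil M u t).IsHermitian := by
  ext i j
  rw [conjTranspose_apply, kippenhahnPencil_apply, kippenhahnPencil_apply]
  by_cases h : i = j
  · subst h
    simp [add_comm]
  · simp [h, Ne.symm h, add_comm]

theorem kippenhahnPencil_fromBlocks {κ : Type*} [DecidableEq κ] (B : Matrix ι ι ℂ)
    (C : Matrix κ κ ℂ) (u : ℂ) (t : ℝ) :
    kippenhahnPencil (fromBlocks B 0 0 C) u t =
      fromBlocks (kippenhahnPencil B u t) 0 0 (kippenhahnPencil C u t) := by
  ext (i | i) (j | j) <;> simp [kippenhahnPencil_apply]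

theorem posDef_kippenhahnPencil_of_lt {M : Matrix ι ι ℂ} {u : ℂ} {s t : ℝ}
    (hK : (kippenhahnPencil M u s).PosSemidef) (hst : s < t) :
    (kippenhahnPencil M u t).PosDef := by
  have : kippenhahnPencil M u t = ((t - s : ℝ) : ℂ) • (1 : Matrix ι ι ℂ) + kippenhahnPencil M u s := by
    simp only [kippenhahnPencil]
    push_cast
    module
  rw [this]
  exact (PosDef.one.smul (by exact_mod_cast sub_pos.2 hst)).add_posSemidef hK

end

section

variable {ι κ : Type*} [Fintype ι] [Fintype κ]

/-- The kernel of `K` has dimension at least two. -/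
def HasDoubleKernel (K : Matrix ι ι ℂ) : Prop :=
  ∃ x y : ι → ℂ, K *ᵥ x = 0 ∧ K *ᵥ y = 0 ∧ ∀ s t : ℂ, s • x + t • y = 0 → s = 0 ∧ t = 0

/-- A two-dimensional space meets every coordinate hyperplane nontrivially. -/
theorem HasDoubleKernel.exists_apply_eq_zero {K : Matrix ι ι ℂ} (hK : HasDoubleKernel K) (i : ι) :
    ∃ z, z ≠ 0 ∧ K *ᵥ z = 0 ∧ z i = 0 := by
  obtain ⟨x, y, hx, hy, hxy⟩ := hK
  by_cases h : x i = 0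
  · refine ⟨x, ?_, hx, h⟩
    rintro rfl
    exact one_ne_zero (hxy 1 0 (by simp)).1
  · refine ⟨y i • x + (-x i) • y, fun h0 => h (neg_eq_zero.1 (hxy _ _ h0).2), ?_, ?_⟩
    · rw [mulVec_add, mulVec_smul, mulVec_smul, hx, hy, smul_zero, smul_zero, add_zero]
    · simp [mul_comm]

theorem fromBlocks_mulVec_eq_zero_iff {B : Matrix ι ι ℂ} {C : Matrix κ κ ℂ} {x : ι ⊕ κ → ℂ} :
    fromBlocks B 0 0 C *ᵥ x = 0 ↔ B *ᵥ (x ∘ Sum.inl) = 0 ∧ C *ᵥ (x ∘ Sum.inr) = 0 := by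
  rw [fromBlocks_mulVec]
  simp only [zero_mulVec, add_zero, zero_add]
  constructor
  · intro h
    exact ⟨funext fun i => congrFun h (Sum.inl i), funext fun i => congrFun h (Sum.inr i)⟩
  · rintro ⟨h1, h2⟩
    rw [h1, h2]
    ext (i | i) <;> rfl

theorem HasDoubleKernel.fromBlocks_right {B : Matrix ι ι ℂ} {C : Matrix κ κ ℂ}
    (h : HasDoubleKernel (fromBlocks B 0 0 C)) (hB : ∀ x, B *ᵥ x = 0 → x = 0) :
    HasDoubleKernel C := by
  obtain ⟨x, y, hx, hy, hxy⟩ := h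
  rw [fromBlocks_mulVec_eq_zero_iff] at hx hy
  refine ⟨_, _, hx.2, hy.2, fun s t hst => hxy s t ?_⟩
  ext (i | i)
  · have h1 := congrFun (hB _ hx.1) i
    have h2 := congrFun (hB _ hy.1) i
    simp only [Function.comp_apply, Pi.zero_apply] at h1 h2
    simp [h1, h2]
  · exact congrFun hst i

end

section

variable {ι κ : Type*} [Fintype ι] [Fintype κ] [DecidableEq ι] [DecidableEq κ]

theorem star_dotProduct_kippenhahnPencil (M : Matrix ι ι ℂ) (u : ℂ) (t : ℝ) (x : ι → ℂ) :
    star x ⬝ᵥ (kippenhahnPencil M u t *ᵥ x) =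
      ((t * ∑ i, ‖x i‖ ^ 2 - 2 * (conj u * (star x ⬝ᵥ (M *ᵥ x))).re : ℝ) : ℂ) := by
  have h1 : star x ⬝ᵥ (Mᴴ *ᵥ x) = conj (star x ⬝ᵥ (M *ᵥ x)) := by
    rw [starRingEnd_apply, ← star_dotProduct_star, star_star, star_mulVec, dotProduct_mulVec]
  have h2 : conj u * (star x ⬝ᵥ (M *ᵥ x)) + u * conj (star x ⬝ᵥ (M *ᵥ x))
      = ((2 * (conj u * (star x ⬝ᵥ (M *ᵥ x))).re : ℝ) : ℂ) := by
    rw [← Complex.add_conj, map_mul, Complex.conj_conj]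
  rw [kippenhahnPencil, sub_mulVec, add_mulVec, smul_mulVec, smul_mulVec, smul_mulVec, one_mulVec,
    dotProduct_sub, dotProduct_add, dotProduct_smul, dotProduct_smul, dotProduct_smul, h1,
    star_dotProduct_self_eq, smul_eq_mul, smul_eq_mul, smul_eq_mul, h2, ← Complex.ofReal_mul,
    ← Complex.ofReal_sub]

theorem posSemidef_kippenhahnPencil_iff (M : Matrix ι ι ℂ) (u : ℂ) (h : ℝ) :
    (kippenhahnPencil M u (2 * h)).PosSemidef ↔
      ∀ z ∈ fieldOfValues M, (conj u * z).re ≤ h := by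
  constructor
  · rintro hK z ⟨x, hx, rfl⟩
    have h1 := hK.dotProduct_mulVec_nonneg x
    rw [star_dotProduct_kippenhahnPencil, Complex.zero_le_real] at h1
    rw [star_dotProduct_self_eq] at hx
    have hx' : ∑ i, ‖x i‖ ^ 2 = 1 := by exact_mod_cast hx
    rw [hx'] at h1
    linarith
  · intro H
    refine PosSemidef.of_dotProduct_mulVec_nonneg (isHermitian_kippenhahnPencil M u _) fun x => ?_
    rcases eq_or_ne x 0 with rfl | hx
    · simp
    rw [star_dotProduct_kippenhahnPencil, Complex.zero_le_real]
    have h1 := H _ (div_mem_fieldOfValues M hx)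
    have hN := sum_norm_sq_pos hx
    rw [star_dotProduct_self_eq, ← mul_div_assoc, Complex.div_ofReal_re, div_le_iff₀ hN] at h1
    linarith

theorem kippenhahnPencil_mulVec_eq_zero {M : Matrix ι ι ℂ} {u : ℂ} {h : ℝ}
    (hK : (kippenhahnPencil M u (2 * h)).PosSemidef) {x : ι → ℂ} (hx : star x ⬝ᵥ x = 1)
    (hxh : (conj u * (star x ⬝ᵥ (M *ᵥ x))).re = h) : kippenhahnPencil M u (2 * h) *ᵥ x = 0 := by
  rw [← hK.dotProduct_mulVec_zero_iff, star_dotProduct_kippenhahnPencil, hxh]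
  rw [star_dotProduct_self_eq] at hx
  have hx' : ∑ i, ‖x i‖ ^ 2 = 1 := by exact_mod_cast hx
  rw [hx']
  simp

theorem IsFlatDirection.posSemidef {M : Matrix ι ι ℂ} {u : ℂ} {h : ℝ}
    (d : IsFlatDirection (fieldOfValues M) u h) : (kippenhahnPencil M u (2 * h)).PosSemidef :=
  (posSemidef_kippenhahnPencil_iff M u h).2 d.le

/-- Unit vectors that produce two points of a face lie in the kernel, and proportional unit vectors
would produce the same point. -/
theorem IsFlatDirection.hasDoubleKernel {M : Matrix ι ι ℂ} {u : ℂ} {h : ℝ}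
    (d : IsFlatDirection (fieldOfValues M) u h) : HasDoubleKernel (kippenhahnPencil M u (2 * h)) := by
  obtain ⟨a, ⟨x, hx, rfl⟩, b, ⟨y, hy, rfl⟩, hab, hah, hbh⟩ := d.nondeg
  refine ⟨x, y, kippenhahnPencil_mulVec_eq_zero d.posSemidef hx hah,
    kippenhahnPencil_mulVec_eq_zero d.posSemidef hy hbh, fun s t hst => ?_⟩
  have ht : t = 0 := by
    by_contra ht
    have hyx : y = (-(t⁻¹ * s)) • x := by
      have h1 : t⁻¹ • (s • x + t • y) = 0 := by rw [hst, smul_zero]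
      rw [smul_add, smul_smul, smul_smul, inv_mul_cancel₀ ht, one_smul] at h1
      rw [neg_smul]
      exact eq_neg_of_add_eq_zero_right h1
    generalize -(t⁻¹ * s) = c at hyx
    rw [hyx, star_smul, smul_dotProduct, dotProduct_smul, hx, smul_eq_mul, smul_eq_mul, mul_one] at hy
    apply hab
    rw [hyx, mulVec_smul, star_smul, smul_dotProduct, dotProduct_smul, smul_eq_mul, smul_eq_mul,
      ← mul_assoc, hy, one_mul]
  refine ⟨?_, ht⟩
  rw [ht, zero_smul, add_zero] at hst
  refine (smul_eq_zero.1 hst).resolve_right ?_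
  rintro rfl
  simp at hx

/-- If the pencil has the same determinant in all directions, then the numerical range is a disc,
and so its boundary has no flat portion. -/
theorem not_isFlatDirection_of_det_eq {M : Matrix ι ι ℂ} {u : ℂ} {h : ℝ}
    (H : ∀ v : ℂ, conj v * v = 1 → ∀ t,
      (kippenhahnPencil M v t).det = (kippenhahnPencil M u t).det) :
    ¬ IsFlatDirection (fieldOfValues M) u h := by
  intro d
  refine not_isFlatDirection_of_norm_le (r := h) (fun z hz => ?_) d
  rcases eq_or_ne z 0 with rfl | hz0
  · simpa using d.le 0 hz
  have hn : (‖z‖ : ℂ) ≠ 0 := by exact_mod_cast norm_ne_zero_iff.2 hz0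
  have hv : conj (z / ‖z‖) * (z / ‖z‖) = 1 := by
    rw [map_div₀, Complex.conj_ofReal, div_mul_div_comm, Complex.conj_mul']
    field_simp
  -- With `k` the support value in the direction of `z`, the determinant vanishes at `2 * k` in that
  -- direction, hence also in direction `u`. Above `2 * h` the latter pencil is positive definite,
  -- so `‖z‖ ≤ k ≤ h` and the range lies in a disc of radius `h`.
  obtain ⟨w, ⟨x, hx, rfl⟩, hmax⟩ := (isCompact_fieldOfValues M).exists_isMaxOn ⟨z, hz⟩
    (f := fun y => (conj (z / ‖z‖) * y).re) (by fun_prop)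
  set k := (conj (z / ‖z‖) * (star x ⬝ᵥ (M *ᵥ x))).re with hk
  have hzk : ‖z‖ ≤ k := by
    have h1 : (conj (z / ‖z‖) * z).re ≤ k := hmax hz
    have h2 : conj (z / ‖z‖) * z = ‖z‖ := by
      rw [map_div₀, Complex.conj_ofReal, div_mul_eq_mul_div, Complex.conj_mul']
      field_simp
    rwa [h2, Complex.ofReal_re] at h1
  have hK : (kippenhahnPencil M (z / ‖z‖) (2 * k)).PosSemidef :=
    (posSemidef_kippenhahnPencil_iff M _ k).2 fun y hy => hmax hy
  have hdet : (kippenhahnPencil M (z / ‖z‖) (2 * k)).det = 0 := by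
    refine exists_mulVec_eq_zero_iff.1 ⟨x, ?_, kippenhahnPencil_mulVec_eq_zero hK hx hk.symm⟩
    rintro rfl
    simp at hx
  refine hzk.trans (not_lt.1 fun hlt => ?_)
  rw [H _ hv] at hdet
  have hpos := posDef_kippenhahnPencil_of_lt d.posSemidef
    (show 2 * h < 2 * k by linarith)
  exact hpos.det_pos.ne' hdet

/-- The pencil has constant diagonal `2 * h`, so `h ≥ 0`. If `h = 0`, a positive semidefinite matrix
with zero diagonal vanishes; no cancellation between `M i j` and `M j i` is possible, so `M = 0` and
the range is a point. -/
theorem IsFlatDirection.supportValue_pos [Nonempty ι] {M : Matrix ι ι ℂ}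
    (hM : ∀ i j, M i j = 0 ∨ M j i = 0) {u : ℂ} {h : ℝ}
    (d : IsFlatDirection (fieldOfValues M) u h) : 0 < h := by
  have hdiag : ∀ i, kippenhahnPencil M u (2 * h) i i = ((2 * h : ℝ) : ℂ) := by
    intro i
    have : M i i = 0 := (hM i i).elim id id
    simp [kippenhahnPencil_apply, this]
  have hnn : 0 ≤ h := by
    obtain ⟨i⟩ := ‹Nonempty ι›
    have h1 := d.posSemidef.diag_nonneg (i := i)
    rw [hdiag, Complex.zero_le_real] at h1
    linarith
  refine lt_of_le_of_ne hnn fun h0 => ?_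
  have hM0 : M = 0 := by
    ext i j
    by_contra hij
    have hcol : kippenhahnPencil M u (2 * h) *ᵥ (Pi.single j 1) = 0 := by
      have h2 := hdiag j
      rw [← d.posSemidef.dotProduct_mulVec_zero_iff, mulVec_single_one, ← Pi.single_star, star_one,
        single_one_dotProduct, col_apply, h2, ← h0]
      simp
    have h1 := congrFun hcol i
    have hji : M j i = 0 := (hM i j).resolve_left hij
    have hne : i ≠ j := by
      rintro rfl
      exact hij hji
    rw [mulVec_single_one, col_apply, kippenhahnPencil_apply, hji] at h1
    simp only [hne, if_false, map_zero, mul_zero, add_zero, zero_sub, Pi.zero_apply, neg_eq_zero,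
      mul_eq_zero] at h1
    rcases h1 with h1 | h1
    · have := d.unit
      rw [h1, zero_mul] at this
      exact zero_ne_one this
    · exact hij h1
  obtain ⟨a, ⟨x, hx, rfl⟩, b, ⟨y, hy, rfl⟩, hab, -⟩ := d.nondeg
  exact hab (by simp [hM0])

end

/-! ### Schur triangularization of nilpotent matrices -/

theorem LinearMap.exists_unit_mem_ker_of_isNilpotent {E : Type*} [NormedAddCommGroup E]
    [InnerProductSpace ℂ E] [Nontrivial E] {f : E →ₗ[ℂ] E} (hf : IsNilpotent f) :
    ∃ v : E, ‖v‖ = 1 ∧ f v = 0 := by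
  have hker : LinearMap.ker f ≠ ⊥ := by
    intro h
    obtain ⟨k, hk⟩ := hf
    have hinj : Function.Injective (f ^ k) := by
      rw [Module.End.coe_pow]
      exact (LinearMap.ker_eq_bot.1 h).iterate k
    obtain ⟨x, y, hxy⟩ := exists_pair_ne E
    exact hxy (hinj (by rw [hk]; rfl))
  obtain ⟨w, hw, hw0⟩ := Submodule.exists_mem_ne_zero_of_ne_bot hker
  have hn : ‖w‖ ≠ 0 := norm_ne_zero_iff.2 hw0
  refine ⟨((‖w‖⁻¹ : ℝ) : ℂ) • w, ?_, ?_⟩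
  · rw [norm_smul, Complex.norm_real, norm_inv, norm_norm, inv_mul_cancel₀ hn]
  · rw [map_smul, LinearMap.mem_ker.1 hw, smul_zero]

/-- **Schur triangularization** of a nilpotent operator. -/
theorem LinearMap.exists_orthonormalBasis_strictUpper (n : ℕ) : ∀ (E : Type) [NormedAddCommGroup E]
    [InnerProductSpace ℂ E] [FiniteDimensional ℂ E], Module.finrank ℂ E = n →
    ∀ f : E →ₗ[ℂ] E, IsNilpotent f →
    ∃ b : OrthonormalBasis (Fin n) ℂ E, ∀ i j, j ≤ i → inner ℂ (b i) (f (b j)) = 0 := by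
  induction n with
  | zero =>
    intro E _ _ _ hE f hf
    exact ⟨(stdOrthonormalBasis ℂ E).reindex (finCongr hE), fun i => i.elim0⟩
  | succ n ih =>
    intro E _ _ _ hE f hf
    have : Nontrivial E := Module.nontrivial_of_finrank_pos (R := ℂ) (by omega)
    obtain ⟨v, hv, hfv⟩ := LinearMap.exists_unit_mem_ker_of_isNilpotent hf
    have hv0 : v ≠ 0 := by
      rintro rfl
      simp at hv
    -- The compression `g` of `f` to the complement of a kernel vector `v` satisfies `g ∘ P = P ∘
    -- f`, because `f` kills `v`; hence `g` is again nilpotent.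
    let K : Submodule ℂ E := (ℂ ∙ v)ᗮ
    let P : E →ₗ[ℂ] K := K.orthogonalProjectionOnto.toLinearMap
    let g : K →ₗ[ℂ] K := P ∘ₗ f ∘ₗ K.subtype
    have hfin : Module.finrank ℂ K = n := by
      have : Fact (Module.finrank ℂ E = n + 1) := ⟨hE⟩
      exact Submodule.finrank_orthogonal_span_singleton hv0
    have hfP : ∀ x, f (P x : E) = f x := by
      intro x
      have h1 : x - (P x : E) ∈ (Kᗮ : Submodule ℂ E) := K.sub_starProjection_mem_orthogonal x
      rw [Submodule.orthogonal_orthogonal, Submodule.mem_span_singleton] at h1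
      obtain ⟨c, hc⟩ := h1
      have h2 : f (x - (P x : E)) = 0 := by rw [← hc, map_smul, hfv, smul_zero]
      rw [map_sub, sub_eq_zero] at h2
      exact h2.symm
    have hgP : ∀ k x, (g ^ k) (P x) = P ((f ^ k) x) := by
      intro k
      induction k with
      | zero => intro x; rfl
      | succ k ihk =>
        intro x
        rw [pow_succ, pow_succ, Module.End.mul_apply, Module.End.mul_apply, ← ihk]
        congr 1
        exact congrArg P (hfP x)
    have hg : IsNilpotent g := by
      obtain ⟨k, hk⟩ := hf
      refine ⟨k, LinearMap.ext fun x => ?_⟩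
      have hPx : P (x : E) = x := K.orthogonalProjectionOnto_mem_subspace_eq_self x
      rw [← hPx, hgP, hk]
      simp
    obtain ⟨b, hb⟩ := ih K hfin g hg
    have hvK : ∀ y : K, inner ℂ v (y : E) = 0 := fun y =>
      Submodule.mem_orthogonal_singleton_iff_inner_right.1 y.2
    let w : Fin (n + 1) → E := Fin.cons v fun i => (b i : E)
    have hw : Orthonormal ℂ w := by
      rw [orthonormal_iff_ite]
      intro i j
      refine Fin.cases ?_ (fun i => ?_) i <;> refine Fin.cases ?_ (fun j => ?_) j
      · simp [w, inner_self_eq_norm_sq_to_K, hv]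
      · simp [w, hvK, (Fin.succ_ne_zero j).symm]
      · simp only [w, Fin.cons_succ, Fin.cons_zero, Fin.succ_ne_zero, if_false]
        rw [← inner_conj_symm, hvK, map_zero]
      · have := orthonormal_iff_ite.1 b.orthonormal i j
        simpa [w] using this
    have hspan : ⊤ ≤ Submodule.span ℂ (Set.range w) := by
      refine (hw.linearIndependent.span_eq_top_of_card_eq_finrank' ?_).ge
      simp [hE]
    refine ⟨OrthonormalBasis.mk hw hspan, fun i j => ?_⟩
    simp only [OrthonormalBasis.coe_mk]
    refine Fin.cases ?_ (fun j => ?_) j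
    · intro _
      simp [w, hfv]
    · refine Fin.cases ?_ (fun i => ?_) i
      · intro h
        simp at h
      · intro hij
        have h1 := hb i j (Fin.succ_le_succ_iff.1 hij)
        simp only [w, Fin.cons_succ]
        rw [← h1, Submodule.coe_inner]
        exact (K.inner_orthogonalProjectionOnto_eq_of_mem_left (b i) _).symm

theorem Matrix.exists_unitary_conj_strictUpper {n : ℕ} {B : Matrix (Fin n) (Fin n) ℂ}
    (hB : IsNilpotent B) : ∃ U : unitaryGroup (Fin n) ℂ,
      ∀ i j, j ≤ i → (star (U : Matrix (Fin n) (Fin n) ℂ) * B * (U : Matrix (Fin n) (Fin n) ℂ)) i j = 0 := by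
  obtain ⟨b, hb⟩ := LinearMap.exists_orthonormalBasis_strictUpper n (EuclideanSpace ℂ (Fin n))
    finrank_euclideanSpace_fin (toEuclideanLin B) (by
      obtain ⟨k, hk⟩ := hB
      exact ⟨k, by rw [← toLpLin_pow, hk, map_zero]⟩)
  let V : Matrix (Fin n) (Fin n) ℂ := of fun i j => b j i
  have hV : ∀ (x : Fin n → ℂ) i, (star V *ᵥ x) i = inner ℂ (b i) (WithLp.toLp 2 x) := by
    intro x i
    rw [EuclideanSpace.inner_eq_star_dotProduct, dotProduct_comm]
    rfl
  have hcol : ∀ j, V *ᵥ Pi.single j 1 = b j := by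
    intro j
    rw [mulVec_single_one]
    rfl
  have hent : ∀ (X : Matrix (Fin n) (Fin n) ℂ) i j, (star V * X * V) i j
      = inner ℂ (b i) (toEuclideanLin X (b j)) := by
    intro X i j
    have : (star V * X * V) i j = ((star V * X * V) *ᵥ Pi.single j 1) i := by
      rw [mulVec_single_one]
      rfl
    rw [this, ← mulVec_mulVec, ← mulVec_mulVec, hcol, hV]
    rfl
  have hU : V ∈ unitaryGroup (Fin n) ℂ := by
    rw [mem_unitaryGroup_iff']
    ext i j
    have h1 := hent 1 i j
    rw [Matrix.mul_one] at h1
    rw [h1, one_apply, ← orthonormal_iff_ite.1 b.orthonormal i j]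
    simp
  exact ⟨⟨V, hU⟩, fun i j hij => (hent B i j).trans (hb i j hij)⟩

/-! ### Principal minors and determinants of small triangular pencils -/

/-- A nonzero kernel vector with vanishing `i`-th coordinate restricts to a kernel vector of the
principal submatrix. -/
theorem HasDoubleKernel.det_submatrix_succAbove_eq_zero {n : ℕ}
    {K : Matrix (Fin (n + 1)) (Fin (n + 1)) ℂ} (hK : HasDoubleKernel K) (i : Fin (n + 1)) :
    (K.submatrix i.succAbove i.succAbove).det = 0 := by
  obtain ⟨z, hz, hKz, hzi⟩ := hK.exists_apply_eq_zero i
  refine exists_mulVec_eq_zero_iff.1 ⟨z ∘ i.succAbove, fun h0 => hz ?_, ?_⟩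
  · ext j
    rcases Fin.eq_self_or_eq_succAbove i j with rfl | ⟨k, rfl⟩
    · exact hzi
    · exact congrFun h0 k
  · ext j
    have h1 := congrFun hKz (i.succAbove j)
    rw [mulVec, dotProduct, Fin.sum_univ_succAbove _ i, hzi, mul_zero, zero_add] at h1
    exact h1

theorem kippenhahnPencil_submatrix {ι κ : Type*} [DecidableEq ι] [DecidableEq κ] (M : Matrix ι ι ℂ)
    (u : ℂ) (t : ℝ) {f : κ → ι} (hf : Function.Injective f) :
    (kippenhahnPencil M u t).submatrix f f = kippenhahnPencil (M.submatrix f f) u t := by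
  ext i j
  simp [kippenhahnPencil_apply, hf.eq_iff]

/-- `M` is strictly upper triangular. -/
def IsStrictUpper {n : ℕ} (M : Matrix (Fin n) (Fin n) ℂ) : Prop := ∀ i j, j ≤ i → M i j = 0

theorem IsStrictUpper.submatrix_succAbove {n : ℕ} {M : Matrix (Fin (n + 1)) (Fin (n + 1)) ℂ}
    (hM : IsStrictUpper M) (i : Fin (n + 1)) :
    IsStrictUpper (M.submatrix i.succAbove i.succAbove) := fun _ _ hjk =>
  hM _ _ ((Fin.strictMono_succAbove i).monotone hjk)

theorem ofReal_two_mul_re (z : ℂ) : ((2 * z.re : ℝ) : ℂ) = z + conj z := (Complex.add_conj z).symm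

theorem ofReal_normSq (z : ℂ) : ((Complex.normSq z : ℝ) : ℂ) = z * conj z := (Complex.mul_conj z).symm

theorem det_kippenhahnPencil_one {M : Matrix (Fin 1) (Fin 1) ℂ} (hM : IsStrictUpper M)
    (u : ℂ) (t : ℝ) : (kippenhahnPencil M u t).det = t := by
  rw [det_fin_one, kippenhahnPencil_apply, hM 0 0 le_rfl]
  simp

theorem det_kippenhahnPencil_two {M : Matrix (Fin 2) (Fin 2) ℂ} (hM : IsStrictUpper M)
    {u : ℂ} (hu : conj u * u = 1) (t : ℝ) :
    (kippenhahnPencil M u t).det = ((t ^ 2 - Complex.normSq (M 0 1) : ℝ) : ℂ) := by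
  rw [Complex.ofReal_sub, ofReal_normSq, det_fin_two]
  simp only [kippenhahnPencil_apply, hM 0 0 le_rfl, hM 1 1 le_rfl, hM 1 0 (by decide)]
  simp
  linear_combination -(M 0 1 * conj (M 0 1)) * hu

theorem det_kippenhahnPencil_three {M : Matrix (Fin 3) (Fin 3) ℂ} (hM : IsStrictUpper M)
    {u : ℂ} (hu : conj u * u = 1) (t : ℝ) :
    (kippenhahnPencil M u t).det = ((t ^ 3 - t * (Complex.normSq (M 0 1) + Complex.normSq (M 0 2) +
      Complex.normSq (M 1 2)) - 2 * (conj u * (M 0 1 * M 1 2 * conj (M 0 2))).re : ℝ) : ℂ) := by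
  rw [Complex.ofReal_sub, ofReal_two_mul_re, Complex.ofReal_sub, Complex.ofReal_mul,
    Complex.ofReal_add, Complex.ofReal_add, ofReal_normSq, ofReal_normSq, ofReal_normSq,
    det_fin_three]
  simp only [kippenhahnPencil_apply, hM 0 0 le_rfl, hM 1 1 le_rfl, hM 2 2 le_rfl,
    hM 1 0 (by decide), hM 2 0 (by decide), hM 2 1 (by decide)]
  simp
  generalize M 0 1 = a
  generalize M 0 2 = b
  generalize M 1 2 = c
  linear_combination (-(t : ℂ) * (a * conj a + b * conj b + c * conj c)
    - (conj u * (a * c * conj b) + u * (conj a * conj c * b))) * hu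

/-- In the permutation expansion, 3-cycles give the linear coefficient in `t`. Among the 4-cycles
only the one through `0, 1, 2, 3` in order has unequally many steps up and down, so it alone carries
`conj u ^ 2`. -/
theorem det_kippenhahnPencil_four {M : Matrix (Fin 4) (Fin 4) ℂ} (hM : IsStrictUpper M)
    {u : ℂ} (hu : conj u * u = 1) (t : ℝ) :
    (kippenhahnPencil M u t).det = ((t ^ 4 - t ^ 2 * (Complex.normSq (M 0 1) +
      Complex.normSq (M 0 2) + Complex.normSq (M 0 3) + Complex.normSq (M 1 2) +
      Complex.normSq (M 1 3) + Complex.normSq (M 2 3))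
      - t * (2 * (conj u * (M 0 1 * M 1 2 * conj (M 0 2) + M 1 2 * M 2 3 * conj (M 1 3) +
        M 0 1 * M 1 3 * conj (M 0 3) + M 0 2 * M 2 3 * conj (M 0 3))).re)
      + (Complex.normSq (M 0 1) * Complex.normSq (M 2 3) +
        Complex.normSq (M 0 2) * Complex.normSq (M 1 3) +
        Complex.normSq (M 0 3) * Complex.normSq (M 1 2))
      - 2 * (conj u ^ 2 * (M 0 1 * M 1 2 * M 2 3 * conj (M 0 3))).re
      - 2 * (M 0 1 * M 1 3 * conj (M 2 3) * conj (M 0 2)).re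
      - 2 * (M 0 2 * conj (M 1 2) * M 1 3 * conj (M 0 3)).re : ℝ) : ℂ) := by
  simp only [Complex.ofReal_sub, Complex.ofReal_add, ofReal_two_mul_re, ofReal_normSq,
    Complex.ofReal_mul (t), Complex.ofReal_mul (t ^ 2), Complex.ofReal_mul (Complex.normSq _),
    Complex.ofReal_pow]
  rw [det_succ_row_zero]
  simp only [Fin.sum_univ_four, det_fin_three, submatrix_apply]
  simp only [kippenhahnPencil_apply]
  have e1 : (Fin.succ 2 : Fin 4) = 3 := rfl
  simp only [Fin.succ_zero_eq_one, Fin.succ_one_eq_two, e1, show ((0 : Fin 4).succAbove 0) = 1 from rfl,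
    show ((0 : Fin 4).succAbove 1) = 2 from rfl, show ((0 : Fin 4).succAbove 2) = 3 from rfl,
    show ((1 : Fin 4).succAbove 0) = 0 from rfl, show ((1 : Fin 4).succAbove 1) = 2 from rfl,
    show ((1 : Fin 4).succAbove 2) = 3 from rfl, show ((2 : Fin 4).succAbove 0) = 0 from rfl,
    show ((2 : Fin 4).succAbove 1) = 1 from rfl, show ((2 : Fin 4).succAbove 2) = 3 from rfl,
    show ((3 : Fin 4).succAbove 0) = 0 from rfl, show ((3 : Fin 4).succAbove 1) = 1 from rfl,
    show ((3 : Fin 4).succAbove 2) = 2 from rfl, hM 0 0 le_rfl, hM 1 1 le_rfl, hM 2 2 le_rfl,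
    hM 3 3 le_rfl, hM 1 0 (by decide), hM 2 0 (by decide), hM 3 0 (by decide), hM 2 1 (by decide),
    hM 3 1 (by decide), hM 3 2 (by decide)]
  generalize M 0 1 = a
  generalize M 0 2 = b
  generalize M 0 3 = c
  generalize M 1 2 = d
  generalize M 1 3 = e
  generalize M 2 3 = f
  simp
  generalize conj u = v at *
  generalize conj a = a' at *
  generalize conj b = b' at *
  generalize conj c = c' at *
  generalize conj d = d' at *
  generalize conj e = e' at *
  generalize conj f = f' at *
  linear_combination (-(t : ℂ) ^ 2 * (a * a' + b * b' + c * c' + d * d' + e * e' + f * f')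
    - t * (v * (a * d * b' + d * f * e' + a * e * c' + b * f * c')
      + u * (a' * d' * b + d' * f' * e + a' * e' * c + b' * f' * c))
    + (v * u + 1) * (a * a' * f * f' + b * b' * e * e' + c * c' * d * d'
      - a * e * f' * b' - a' * e' * f * b - b * d' * e * c' - b' * d * e' * c)
    - v ^ 2 * (a * d * f * c') - u ^ 2 * (a' * d' * f' * c)) * hu

/-! ### Double largest root of a product of two quadratics -/

/-- The position of the double largest root of `((t - q)² - (s + w)) * ((t + q)² - (s - w))`. -/
theorem sqrt_sub_sqrt_of_double_root {s q w t : ℝ} (hq : 0 < q) (hw : |w| ≤ s)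
    (h0 : ((t - q) ^ 2 - (s + w)) * ((t + q) ^ 2 - (s - w)) = 0)
    (h1 : t ^ 3 = (s + q ^ 2) * t + q * w)
    (hmax : ∀ r, t < r → ((r - q) ^ 2 - (s + w)) * ((r + q) ^ 2 - (s - w)) ≠ 0) :
    √(s - w) - √(s + w) = 2 * q ∨ s + w = 0 ∧ √(s - w) ≤ 2 * q := by
  obtain ⟨hw1, hw2⟩ := abs_le.1 hw
  have hP := Real.sqrt_nonneg (s + w)
  have hM := Real.sqrt_nonneg (s - w)
  have hP2 := Real.sq_sqrt (show 0 ≤ s + w by linarith)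
  have hM2 := Real.sq_sqrt (show 0 ≤ s - w by linarith)
  set P := √(s + w)
  set M := √(s - w)
  have hPt : q + P ≤ t := by
    by_contra h
    refine hmax (q + P) (not_le.1 h) ?_
    rw [← hP2]
    ring
  have hMt : M - q ≤ t := by
    by_contra h
    refine hmax (M - q) (not_le.1 h) ?_
    rw [← hM2]
    ring
  -- This is half the derivative of the product, so `h1` says that `t` is a critical point.
  have hder : (t - q) * ((t + q) ^ 2 - M ^ 2) + (t + q) * ((t - q) ^ 2 - P ^ 2) = 0 := by
    rw [hP2, hM2]
    linear_combination 2 * h1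
  rw [← hP2, ← hM2] at h0
  -- Since `t` dominates the upper roots `q + P` and `M - q`, the factor that vanishes at `t` does
  -- so at its upper root.
  have hroot : t = q + P ∨ t = M - q := by
    rcases mul_eq_zero.1 h0 with h | h
    · left
      nlinarith
    · right
      nlinarith
  rcases hroot with ht | ht
  · have h2 : P * ((2 * q + P - M) * (2 * q + P + M)) = 0 := by
      rw [ht] at hder
      linear_combination hder
    rcases mul_eq_zero.1 h2 with h3 | h3
    · right
      refine ⟨by rw [← hP2, h3]; ring, by linarith⟩
    · left
      have : 2 * q + P - M = 0 := (mul_eq_zero.1 h3).resolve_right (by linarith)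
      linarith
  · have h2 : M * ((M - 2 * q - P) * (M - 2 * q + P)) = 0 := by
      rw [ht] at hder
      linear_combination hder
    left
    rcases mul_eq_zero.1 h2 with h3 | h3
    · linarith
    rcases mul_eq_zero.1 h3 with h3 | h3 <;> linarith

/-- The difference `√(s - w) - √(s + w)` is strictly decreasing on `[-s, s]`. The alternative `s + w
= 0` is the left endpoint, where the largest value is already at most `2 * q`. -/
theorem eq_of_sqrt_sub_sqrt {s q w w' : ℝ} (hw : |w| ≤ s) (hw' : |w'| ≤ s)
    (h : √(s - w) - √(s + w) = 2 * q ∨ s + w = 0 ∧ √(s - w) ≤ 2 * q)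
    (h' : √(s - w') - √(s + w') = 2 * q ∨ s + w' = 0 ∧ √(s - w') ≤ 2 * q) : w = w' := by
  wlog hlt : w < w' generalizing w w'
  · rcases lt_trichotomy w w' with h1 | h1 | h1
    · exact this hw hw' h h' h1
    · exact h1
    · exact (this hw' hw h' h h1).symm
  exfalso
  obtain ⟨a1, a2⟩ := abs_le.1 hw
  obtain ⟨b1, b2⟩ := abs_le.1 hw'
  have h1 : √(s + w) < √(s + w') := Real.sqrt_lt_sqrt (by linarith) (by linarith)
  have h2 : √(s - w') < √(s - w) := Real.sqrt_lt_sqrt (by linarith) (by linarith)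
  rcases h with h | ⟨h, h3⟩
  · rcases h' with h' | ⟨h', h3'⟩
    · linarith
    · linarith
  · rcases h' with h' | ⟨h', h3'⟩
    · rw [h, Real.sqrt_zero] at h1
      linarith
    · linarith

theorem normSq_conj_mul {u : ℂ} (hu : conj u * u = 1) (z : ℂ) :
    Complex.normSq (conj u * z) = Complex.normSq z := by
  rw [map_mul, Complex.normSq_conj, Complex.normSq_eq_norm_sq u, norm_of_conj_mul_self hu, one_pow,
    one_mul]

/-! ### Three flat directions: blocks of sizes one and four -/

/-- If in three flat directions the support values satisfy two cubic equations of the shape arising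
from principal minors, then the equations coincide. -/
theorem coeff_eq_of_three_flatDirections {F : Set ℂ} {u₁ u₂ u₃ : ℂ} {h₁ h₂ h₃ : ℝ}
    (d₁ : IsFlatDirection F u₁ h₁) (d₂ : IsFlatDirection F u₂ h₂) (d₃ : IsFlatDirection F u₃ h₃)
    (h₁₂ : u₁ ≠ u₂) (h₁₃ : u₁ ≠ u₃) (h₂₃ : u₂ ≠ u₃) {n n' : ℝ} {τ τ' : ℂ}
    (H : ∀ u h, IsFlatDirection F u h → (2 * h) ^ 3 - (2 * h) * n - 2 * (conj u * τ).re = 0)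
    (H' : ∀ u h, IsFlatDirection F u h → (2 * h) ^ 3 - (2 * h) * n' - 2 * (conj u * τ').re = 0) :
    n = n' ∧ τ = τ' := by
  have key : ∀ u h, IsFlatDirection F u h → (conj u * (τ' - τ)).re = h * (n - n') := by
    intro u h d
    have e1 := H u h d
    have e2 := H' u h d
    rw [mul_sub, Complex.sub_re]
    linarith
  have hn : n = n' := by
    by_contra hne
    have hne' := sub_ne_zero.2 hne
    -- Subtracting the cubics leaves a linear relation, which says that the supporting line passes
    -- through `(τ' - τ) / (n - n')`.
    have conc : ∀ u h, IsFlatDirection F u h →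
        (conj u * ((τ' - τ) / ((n - n' : ℝ) : ℂ))).re = h := by
      intro u h d
      rw [← mul_div_assoc, Complex.div_ofReal_re, key u h d, mul_div_cancel_right₀ _ hne']
    exact not_concurrent d₁ d₂ d₃ h₁₂ h₁₃ h₂₃ _ (conc _ _ d₁) (conc _ _ d₂) (conc _ _ d₃)
  refine ⟨hn, ?_⟩
  have key0 : ∀ u h, IsFlatDirection F u h → (conj u * (τ' - τ)).re = 0 := by
    intro u h d
    rw [key u h d, hn, sub_self, mul_zero]
  have h0 := eq_zero_of_re_conj_mul_eq d₁.unit d₂.unit d₃.unit h₁₂ h₁₃ h₂₃ 0 (key0 _ _ d₁)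
    (key0 _ _ d₂) (key0 _ _ d₃)
  exact (sub_eq_zero.1 h0).symm

theorem IsStrictUpper.apply_eq_zero_or {k m : ℕ} {B : Matrix (Fin k) (Fin k) ℂ}
    {C : Matrix (Fin m) (Fin m) ℂ} (hB : IsStrictUpper B) (hC : IsStrictUpper C)
    (i j : Fin k ⊕ Fin m) : fromBlocks B 0 0 C i j = 0 ∨ fromBlocks B 0 0 C j i = 0 := by
  rcases i with i | i <;> rcases j with j | j
  · exact (le_total j i).imp (hB i j) (hB j i)
  · exact Or.inl rfl
  · exact Or.inl rfl
  · exact (le_total j i).imp (hC i j) (hC j i)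

theorem det_kippenhahnPencil_fromBlocks {k m : ℕ} (B : Matrix (Fin k) (Fin k) ℂ)
    (C : Matrix (Fin m) (Fin m) ℂ) (u : ℂ) (t : ℝ) :
    (kippenhahnPencil (fromBlocks B 0 0 C) u t).det =
      (kippenhahnPencil B u t).det * (kippenhahnPencil C u t).det := by
  rw [kippenhahnPencil_fromBlocks, det_fromBlocks_zero₂₁]

theorem Matrix.PosSemidef.of_fromBlocks_left {k m : ℕ} {B : Matrix (Fin k) (Fin k) ℂ}
    {C : Matrix (Fin m) (Fin m) ℂ} (h : (fromBlocks B 0 0 C).PosSemidef) : B.PosSemidef :=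
  h.submatrix Sum.inl

theorem Matrix.PosSemidef.of_fromBlocks_right {k m : ℕ} {B : Matrix (Fin k) (Fin k) ℂ}
    {C : Matrix (Fin m) (Fin m) ℂ} (h : (fromBlocks B 0 0 C).PosSemidef) : C.PosSemidef :=
  h.submatrix Sum.inr

theorem eq_or_eq_of_sq_eq_sq {u₁ u₂ u₃ : ℂ} (h₁₂ : u₁ ^ 2 = u₂ ^ 2) (h₁₃ : u₁ ^ 2 = u₃ ^ 2) :
    u₁ = u₂ ∨ u₁ = u₃ ∨ u₂ = u₃ := by
  rcases sq_eq_sq_iff_eq_or_eq_neg.1 h₁₂ with h | h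
  · exact Or.inl h
  rcases sq_eq_sq_iff_eq_or_eq_neg.1 h₁₃ with h' | h'
  · exact Or.inr (Or.inl h')
  · exact Or.inr (Or.inr (neg_injective (h.symm.trans h')))

/-- The four 3 × 3 minors force equal moduli of complementary entries and a common triple product
`τ`. The cases `τ = 0` and `τ ≠ 0` then limit the directions through `u ^ 2` and through `Re (conj u
* τ)` respectively. -/
theorem not_three_flatDirections_one_four {B : Matrix (Fin 1) (Fin 1) ℂ}
    {C : Matrix (Fin 4) (Fin 4) ℂ} (hB : IsStrictUpper B) (hC : IsStrictUpper C)
    {u₁ u₂ u₃ : ℂ} {h₁ h₂ h₃ : ℝ}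
    (d₁ : IsFlatDirection (fieldOfValues (fromBlocks B 0 0 C)) u₁ h₁)
    (d₂ : IsFlatDirection (fieldOfValues (fromBlocks B 0 0 C)) u₂ h₂)
    (d₃ : IsFlatDirection (fieldOfValues (fromBlocks B 0 0 C)) u₃ h₃)
    (h₁₂ : u₁ ≠ u₂) (h₁₃ : u₁ ≠ u₃) (h₂₃ : u₂ ≠ u₃) : False := by
  set F := fieldOfValues (fromBlocks B 0 0 C) with hF
  have hpos : ∀ u h, IsFlatDirection F u h → 0 < h := fun u h d =>
    d.supportValue_pos (hB.apply_eq_zero_or hC)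
  have hker : ∀ u h, IsFlatDirection F u h → HasDoubleKernel (kippenhahnPencil C u (2 * h)) := by
    intro u h d
    have h1 := d.hasDoubleKernel
    rw [kippenhahnPencil_fromBlocks] at h1
    refine h1.fromBlocks_right fun x hx => ?_
    by_contra hx0
    have h2 := exists_mulVec_eq_zero_iff.1 ⟨x, hx0, hx⟩
    rw [det_kippenhahnPencil_one hB] at h2
    have h3 : 2 * h = 0 := by exact_mod_cast h2
    have := hpos u h d
    linarith
  have hpsd : ∀ u h, IsFlatDirection F u h → (kippenhahnPencil C u (2 * h)).PosSemidef := by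
    intro u h d
    have h1 := d.posSemidef
    rw [kippenhahnPencil_fromBlocks] at h1
    exact h1.of_fromBlocks_right
  have hminor : ∀ i : Fin 4, ∀ u h, IsFlatDirection F u h →
      (2 * h) ^ 3 - (2 * h) * (Complex.normSq (C (i.succAbove 0) (i.succAbove 1)) +
        Complex.normSq (C (i.succAbove 0) (i.succAbove 2)) +
        Complex.normSq (C (i.succAbove 1) (i.succAbove 2))) -
      2 * (conj u * (C (i.succAbove 0) (i.succAbove 1) * C (i.succAbove 1) (i.succAbove 2) *
        conj (C (i.succAbove 0) (i.succAbove 2)))).re = 0 := by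
    intro i u h d
    have h1 := (hker u h d).det_submatrix_succAbove_eq_zero i
    rw [kippenhahnPencil_submatrix _ _ _ Fin.succAbove_right_injective,
      det_kippenhahnPencil_three (hC.submatrix_succAbove i) d.unit] at h1
    exact_mod_cast h1
  have hdet : ∀ u h, IsFlatDirection F u h → (kippenhahnPencil C u (2 * h)).det = 0 := by
    intro u h d
    obtain ⟨z, hz, hKz, -⟩ := (hker u h d).exists_apply_eq_zero 0
    exact exists_mulVec_eq_zero_iff.1 ⟨z, hz, hKz⟩
  have m3 := hminor 3
  have m0 := hminor 0
  have m2 := hminor 2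
  have m1 := hminor 1
  simp only [show ((0 : Fin 4).succAbove 0) = 1 from rfl,
    show ((0 : Fin 4).succAbove 1) = 2 from rfl, show ((0 : Fin 4).succAbove 2) = 3 from rfl,
    show ((1 : Fin 4).succAbove 0) = 0 from rfl, show ((1 : Fin 4).succAbove 1) = 2 from rfl,
    show ((1 : Fin 4).succAbove 2) = 3 from rfl, show ((2 : Fin 4).succAbove 0) = 0 from rfl,
    show ((2 : Fin 4).succAbove 1) = 1 from rfl, show ((2 : Fin 4).succAbove 2) = 3 from rfl,
    show ((3 : Fin 4).succAbove 0) = 0 from rfl, show ((3 : Fin 4).succAbove 1) = 1 from rfl,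
    show ((3 : Fin 4).succAbove 2) = 2 from rfl] at m0 m1 m2 m3
  have hdisc : ¬ ∀ v w : ℂ, conj v * v = 1 → conj w * w = 1 → ∀ t,
      (kippenhahnPencil C v t).det = (kippenhahnPencil C w t).det := by
    intro H
    refine not_isFlatDirection_of_det_eq (fun v hv t => ?_) d₁
    rw [det_kippenhahnPencil_fromBlocks, det_kippenhahnPencil_fromBlocks,
      det_kippenhahnPencil_one hB, det_kippenhahnPencil_one hB, H v u₁ hv d₁.unit]
  have hd4 : ∀ u : ℂ, conj u * u = 1 → ∀ t, _ := fun u hu t => det_kippenhahnPencil_four hC hu t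
  obtain ⟨n0, t0⟩ := coeff_eq_of_three_flatDirections d₁ d₂ d₃ h₁₂ h₁₃ h₂₃ m3 m0
  obtain ⟨n2, t2⟩ := coeff_eq_of_three_flatDirections d₁ d₂ d₃ h₁₂ h₁₃ h₂₃ m3 m2
  obtain ⟨n1, t1⟩ := coeff_eq_of_three_flatDirections d₁ d₂ d₃ h₁₂ h₁₃ h₂₃ m3 m1
  clear m0 m1 m2 hminor
  generalize C 0 1 = a at *
  generalize C 0 2 = b at *
  generalize C 0 3 = c at *
  generalize C 1 2 = d at *
  generalize C 1 3 = e at *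
  generalize C 2 3 = f at *
  -- The four equal sums over index triples have this as their only solution: entries at disjoint
  -- index pairs have equal modulus.
  have hcd : Complex.normSq d = Complex.normSq c := by linarith
  have hbe : Complex.normSq e = Complex.normSq b := by linarith
  have haf : Complex.normSq f = Complex.normSq a := by linarith
  rw [hcd, hbe, haf, ← t0, ← t2, ← t1] at hd4
  rw [hcd] at m3
  set τ := a * d * conj b with hτ
  have hτN : Complex.normSq τ = Complex.normSq a * Complex.normSq c * Complex.normSq b := by
    rw [hτ, map_mul, map_mul, Complex.normSq_conj, hcd]
  by_cases hτ0 : τ = 0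
  -- With `τ = 0` the cubic determines `(2 * h) ^ 2`, so `h` is the same in all flat directions.
  · have ht : ∀ u h, IsFlatDirection F u h →
        (2 * h) ^ 2 = Complex.normSq a + Complex.normSq b + Complex.normSq c := by
      intro u h dd
      have e1 := m3 u h dd
      have e2 := hpos u h dd
      rw [hτ0, mul_zero, Complex.zero_re] at e1
      have e3 : (2 * h) * ((2 * h) ^ 2 - (Complex.normSq a + Complex.normSq b + Complex.normSq c)) = 0 := by
        linear_combination e1
      rcases mul_eq_zero.1 e3 with e4 | e4
      · linarith
      · linarith
    by_cases hκ0 : a * d * f * conj c = 0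
    · refine hdisc fun v w hv hw t => ?_
      rw [hd4 v hv, hd4 w hw, hτ0, hκ0]
      simp
    have hb : b = 0 := by
      have : a * d ≠ 0 := fun h => hκ0 (by rw [h]; ring)
      simpa using (mul_eq_zero.1 hτ0).resolve_left this
    have he : e = 0 := by
      rw [hb] at hbe
      simpa using hbe
    -- The quartic fixes the real part, and that equals minus the modulus, so the number is real and
    -- `u ^ 2` is determined.
    have hre : ∀ u h, IsFlatDirection F u h → conj u ^ 2 * (a * d * f * conj c) =
        -((Complex.normSq a * Complex.normSq c : ℝ) : ℂ) := by
      intro u h dd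
      have e1 := hdet u h dd
      rw [hd4 u dd.unit, hτ0, hb, he] at e1
      have e2 := ht u h dd
      rw [hb] at e2
      have e3 : (conj u ^ 2 * (a * d * f * conj c)).re
          = -(Complex.normSq a * Complex.normSq c) := by
        have e4 := Complex.ofReal_eq_zero.1 e1
        simp at e4 e2
        have e5 : (2 * h) ^ 4 = (Complex.normSq a + Complex.normSq c) ^ 2 := by rw [← e2]; ring
        rw [e5, e2] at e4
        simp
        linarith
      have e6 : Complex.normSq (conj u ^ 2 * (a * d * f * conj c))
          = (Complex.normSq a * Complex.normSq c) ^ 2 := by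
        rw [sq (conj u), mul_assoc, normSq_conj_mul dd.unit, normSq_conj_mul dd.unit]
        simp only [map_mul, Complex.normSq_conj, hcd, haf]
        ring
      rw [Complex.normSq_apply, e3] at e6
      have e7 : (conj u ^ 2 * (a * d * f * conj c)).im = 0 := by nlinarith
      exact Complex.ext (by rw [e3]; simp) (by rw [e7]; simp)
    have hsq : ∀ u h u' h', IsFlatDirection F u h → IsFlatDirection F u' h' → u ^ 2 = u' ^ 2 := by
      intro u h u' h' dd dd'
      have e1 := mul_right_cancel₀ hκ0 ((hre u h dd).trans (hre u' h' dd').symm)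
      rw [← map_pow, ← map_pow] at e1
      exact (starRingEnd ℂ).injective e1
    rcases eq_or_eq_of_sq_eq_sq (hsq _ _ _ _ d₁ d₂) (hsq _ _ _ _ d₁ d₃) with h | h | h
    · exact h₁₂ h
    · exact h₁₃ h
    · exact h₂₃ h
  · have hN0 : Complex.normSq a * Complex.normSq c * Complex.normSq b ≠ 0 := by
      rw [← hτN]
      exact fun h => hτ0 (Complex.normSq_eq_zero.1 h)
    have hb0 : Complex.normSq b ≠ 0 := right_ne_zero_of_mul hN0
    have ha0 : Complex.normSq a ≠ 0 := left_ne_zero_of_mul (left_ne_zero_of_mul hN0)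
    have hc0 : Complex.normSq c ≠ 0 := right_ne_zero_of_mul (left_ne_zero_of_mul hN0)
    have hττ : τ * conj τ = ((Complex.normSq a * Complex.normSq c * Complex.normSq b : ℝ) : ℂ) := by
      rw [Complex.mul_conj, hτN]
    -- Equality of the triple products evaluates all three 4-cycle products in terms of moduli and
    -- `τ`.
    have cyc1 : a * e * conj f * conj b = ((Complex.normSq a * Complex.normSq b : ℝ) : ℂ) := by
      have h1 : (Complex.normSq c : ℂ) ≠ 0 := by exact_mod_cast hc0
      apply mul_left_cancel₀ h1
      calc (Complex.normSq c : ℂ) * (a * e * conj f * conj b)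
          = (a * e * conj c) * conj (b * f * conj c) := by
            rw [ofReal_normSq]
            simp only [map_mul, Complex.conj_conj]
            ring
        _ = τ * conj τ := by rw [← t1, ← t2]
        _ = _ := by rw [hττ]; push_cast; ring
    have cyc2 : b * conj d * e * conj c = ((Complex.normSq b * Complex.normSq c : ℝ) : ℂ) := by
      have h1 : (Complex.normSq a : ℂ) ≠ 0 := by exact_mod_cast ha0
      apply mul_left_cancel₀ h1
      calc (Complex.normSq a : ℂ) * (b * conj d * e * conj c)
          = (a * e * conj c) * conj (a * d * conj b) := by
            rw [ofReal_normSq]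
            simp only [map_mul, Complex.conj_conj]
            ring
        _ = τ * conj τ := by rw [← t2]
        _ = _ := by rw [hττ]; push_cast; ring
    have cyc3 : (Complex.normSq b : ℂ) * (a * d * f * conj c) = τ ^ 2 := by
      calc (Complex.normSq b : ℂ) * (a * d * f * conj c)
          = (a * d * conj b) * (b * f * conj c) := by
            rw [ofReal_normSq]
            ring
        _ = τ ^ 2 := by rw [← t1, ← hτ]; ring
    have hb1 : 0 < Complex.normSq b := lt_of_le_of_ne (Complex.normSq_nonneg b) hb0.symm
    have hq : 0 < √(Complex.normSq b) := Real.sqrt_pos.2 hb1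
    have hq2 := Real.sq_sqrt hb1.le
    set q := √(Complex.normSq b) with hqdef
    set s := Complex.normSq a + Complex.normSq c with hs
    have hX : ∀ u : ℂ, conj u * u = 1 → (conj u * τ).re ^ 2 + (conj u * τ).im ^ 2 =
        Complex.normSq a * Complex.normSq c * q ^ 2 := by
      intro u hu
      have h1 := (normSq_conj_mul hu τ).trans hτN
      rw [Complex.normSq_apply] at h1
      rw [hq2]
      linarith
    -- After these substitutions the quartic is a product of two quadratics centred at `q = |b|` and
    -- `-q`; `u` enters only through `w = 2 Re (conj u * τ) / q`.
    have hfac : ∀ u : ℂ, conj u * u = 1 → ∀ t : ℝ, (kippenhahnPencil C u t).det =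
        ((((t - q) ^ 2 - (s + 2 * (conj u * τ).re / q)) *
          ((t + q) ^ 2 - (s - 2 * (conj u * τ).re / q)) : ℝ) : ℂ) := by
      intro u hu t
      rw [hd4 u hu t, cyc1, cyc2]
      congr 1
      have h1 : q ^ 2 * (conj u ^ 2 * (a * d * f * conj c)).re =
          (conj u * τ).re ^ 2 - (conj u * τ).im ^ 2 := by
        have h2 : ((q ^ 2 : ℝ) : ℂ) * (conj u ^ 2 * (a * d * f * conj c)) = (conj u * τ) ^ 2 := by
          rw [hq2, mul_left_comm, cyc3]
          ring
        have h3 := congrArg Complex.re h2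
        rw [Complex.re_ofReal_mul, sq (conj u * τ)] at h3
        rw [h3, Complex.mul_re (conj u * τ)]
        ring
      have h4 := hX u hu
      have h5 : (conj u * (τ + τ + τ + τ)).re = 4 * (conj u * τ).re := by
        rw [show conj u * (τ + τ + τ + τ) = ((4 : ℝ) : ℂ) * (conj u * τ) by push_cast; ring,
          Complex.re_ofReal_mul]
      rw [h5, Complex.ofReal_re, Complex.ofReal_re, ← hq2]
      generalize (conj u * τ).re = X at *
      generalize (conj u * τ).im = Y at *
      generalize (conj u ^ 2 * (a * d * f * conj c)).re = Z at *
      have hZ : Z = (X ^ 2 - Y ^ 2) / q ^ 2 := by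
        rw [← h1]
        field_simp
      have hY : Y ^ 2 = Complex.normSq a * Complex.normSq c * q ^ 2 - X ^ 2 := by linarith
      rw [hZ, hY, hs]
      field_simp
      ring
    have hwle : ∀ u : ℂ, conj u * u = 1 → |2 * (conj u * τ).re / q| ≤ s := by
      intro u hu
      have ha1 := Complex.normSq_nonneg a
      have hc1 := Complex.normSq_nonneg c
      apply abs_le_of_sq_le_sq _ (by positivity)
      have h1 := hX u hu
      rw [div_pow, div_le_iff₀ (by positivity)]
      nlinarith [sq_nonneg (conj u * τ).im, mul_nonneg (sq_nonneg (Complex.normSq a - Complex.normSq c)) (sq_nonneg q)]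
    -- The derivative of the quartic is the sum of its four principal minors, which are now the same
    -- cubic; so `m3` is the critical point condition. Positive definiteness beyond `2 * h` excludes
    -- larger roots.
    have hext : ∀ u h, IsFlatDirection F u h → _ := fun u h dd =>
      sqrt_sub_sqrt_of_double_root (s := s) (q := q) (w := 2 * (conj u * τ).re / q) (t := 2 * h) hq
        (hwle u dd.unit) (by
          have h1 := hdet u h dd
          rw [hfac u dd.unit] at h1
          exact_mod_cast h1) (by
          have h1 := m3 u h dd
          rw [hq2, mul_div_cancel₀ _ hq.ne']
          linear_combination h1) (fun r hr h0 => by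
          have h1 := (posDef_kippenhahnPencil_of_lt (hpsd u h dd) hr).det_pos.ne'
          rw [hfac u dd.unit, h0] at h1
          exact h1 Complex.ofReal_zero)
    have hXeq : ∀ u h u' h', IsFlatDirection F u h → IsFlatDirection F u' h' →
        (conj u * τ).re = (conj u' * τ).re := by
      intro u h u' h' dd dd'
      have h1 := eq_of_sqrt_sub_sqrt (hwle u dd.unit) (hwle u' dd'.unit) (hext u h dd) (hext u' h' dd')
      have h2 := (div_left_inj' hq.ne').1 h1
      linarith
    exact hτ0 (eq_zero_of_re_conj_mul_eq d₁.unit d₂.unit d₃.unit h₁₂ h₁₃ h₂₃ _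
      rfl (hXeq _ _ _ _ d₂ d₁) (hXeq _ _ _ _ d₃ d₁))

/-! ### Three flat directions: blocks of sizes two and three -/

/-- In a direction where the pencil of a strictly upper triangular `3 × 3` matrix has a double
kernel, all moduli of the entries agree. -/
theorem HasDoubleKernel.three {C : Matrix (Fin 3) (Fin 3) ℂ} (hC : IsStrictUpper C) {u : ℂ}
    (hu : conj u * u = 1) {t : ℝ} (h : HasDoubleKernel (kippenhahnPencil C u t)) :
    Complex.normSq (C 0 1) = t ^ 2 ∧ Complex.normSq (C 0 2) = t ^ 2 ∧
      Complex.normSq (C 1 2) = t ^ 2 ∧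
      (conj u * (C 0 1 * C 1 2 * conj (C 0 2))).re = -t ^ 3 := by
  have hminor : ∀ i : Fin 3, t ^ 2 - Complex.normSq (C (i.succAbove 0) (i.succAbove 1)) = 0 := by
    intro i
    have h1 := h.det_submatrix_succAbove_eq_zero i
    rw [kippenhahnPencil_submatrix _ _ _ Fin.succAbove_right_injective,
      det_kippenhahnPencil_two (hC.submatrix_succAbove i) hu] at h1
    exact_mod_cast h1
  have m0 : t ^ 2 - Complex.normSq (C 1 2) = 0 := hminor 0
  have m1 : t ^ 2 - Complex.normSq (C 0 2) = 0 := hminor 1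
  have m2 : t ^ 2 - Complex.normSq (C 0 1) = 0 := hminor 2
  have hdet : t ^ 3 - t * (Complex.normSq (C 0 1) + Complex.normSq (C 0 2) +
      Complex.normSq (C 1 2)) - 2 * (conj u * (C 0 1 * C 1 2 * conj (C 0 2))).re = 0 := by
    obtain ⟨z, hz, hKz, -⟩ := h.exists_apply_eq_zero 0
    have h1 := exists_mulVec_eq_zero_iff.1 ⟨z, hz, hKz⟩
    rw [det_kippenhahnPencil_three hC hu] at h1
    exact_mod_cast h1
  refine ⟨by linarith, by linarith, by linarith, ?_⟩
  linear_combination -(1 / 2) * hdet + (t / 2) * m0 + (t / 2) * m1 + (t / 2) * m2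

/-- There is at most one direction in which the pencil of a strictly upper triangular `3 × 3` matrix
has a double kernel. -/
theorem HasDoubleKernel.three_unique {C : Matrix (Fin 3) (Fin 3) ℂ} (hC : IsStrictUpper C) {u v : ℂ}
    (hu : conj u * u = 1) (hv : conj v * v = 1) {s t : ℝ} (hs : 0 < s) (ht : 0 < t)
    (h : HasDoubleKernel (kippenhahnPencil C u s)) (h' : HasDoubleKernel (kippenhahnPencil C v t)) :
    u = v := by
  obtain ⟨a1, a2, a3, a4⟩ := h.three hC hu
  obtain ⟨b1, b2, b3, b4⟩ := h'.three hC hv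
  have hst : s = t := by
    have : s ^ 2 = t ^ 2 := a1.symm.trans b1
    exact (pow_left_inj₀ hs.le ht.le two_ne_zero).1 this
  subst hst
  set τ := C 0 1 * C 1 2 * conj (C 0 2) with hτ
  have hN : Complex.normSq τ = s ^ 6 := by
    rw [hτ, map_mul, map_mul, Complex.normSq_conj, a1, a2, a3]
    ring
  -- The real part has absolute value equal to the modulus `s ^ 3`, so the imaginary part vanishes
  -- and `w` is determined.
  have key : ∀ w : ℂ, conj w * w = 1 → (conj w * τ).re = -s ^ 3 → conj w * τ = ((-s ^ 3 : ℝ) : ℂ) := by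
    intro w hw hre
    have h1 := (normSq_conj_mul hw τ).trans hN
    rw [Complex.normSq_apply, hre] at h1
    have h2 : (conj w * τ).im = 0 := by nlinarith
    exact Complex.ext (by rw [hre, Complex.ofReal_re]) (by rw [h2, Complex.ofReal_im])
  have hτ0 : τ ≠ 0 := by
    intro h0
    rw [h0, map_zero] at hN
    exact (pow_pos hs 6).ne hN
  have h1 := mul_right_cancel₀ hτ0 ((key u hu a4).trans (key v hv b4).symm)
  exact (starRingEnd ℂ).injective h1

/-- The kernel of a direct sum with a `2 × 2` pencil: it is contained in the second summand, or
both summands are singular. -/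
theorem HasDoubleKernel.two_three {B : Matrix (Fin 2) (Fin 2) ℂ} (hB : IsStrictUpper B)
    {C : Matrix (Fin 3) (Fin 3) ℂ} {u : ℂ} {t : ℝ} (ht : 0 < t)
    (h : HasDoubleKernel (kippenhahnPencil (fromBlocks B 0 0 C) u t)) :
    HasDoubleKernel (kippenhahnPencil C u t) ∨
      (kippenhahnPencil B u t).det = 0 ∧ (kippenhahnPencil C u t).det = 0 := by
  rw [kippenhahnPencil_fromBlocks] at h
  by_cases hdet : (kippenhahnPencil B u t).det = 0
  · right
    refine ⟨hdet, ?_⟩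
    obtain ⟨z, hz, hKz, hz0⟩ := h.exists_apply_eq_zero (Sum.inl 0)
    rw [fromBlocks_mulVec_eq_zero_iff] at hKz
    refine exists_mulVec_eq_zero_iff.1 ⟨_, fun h0 => hz ?_, hKz.2⟩
    -- The diagonal entry `t ≠ 0` kills the remaining coordinate in the 2 × 2 block, so the kernel
    -- vector lives in the other block.
    have h1 := congrFun hKz.1 1
    simp only [mulVec, dotProduct, Fin.sum_univ_two, Function.comp_apply, hz0,
      kippenhahnPencil_apply, hB 1 1 le_rfl] at h1
    have hz1 : z (Sum.inl 1) = 0 := by simpa [ht.ne'] using h1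
    ext (i | i)
    · fin_cases i
      · exact hz0
      · exact hz1
    · exact congrFun h0 i
  · left
    refine h.fromBlocks_right fun x hx => ?_
    by_contra hx0
    exact hdet (exists_mulVec_eq_zero_iff.1 ⟨x, hx0, hx⟩)

/-- Once double kernels of the 3 × 3 block are excluded, all three support values equal half the
modulus of `B 0 1`; equal support values make `Re (conj u * τ)` constant, hence `τ = 0` and the
range a disc. -/
theorem not_three_flatDirections_two_three {B : Matrix (Fin 2) (Fin 2) ℂ}
    {C : Matrix (Fin 3) (Fin 3) ℂ} (hB : IsStrictUpper B) (hC : IsStrictUpper C)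
    {u₁ u₂ u₃ : ℂ} {h₁ h₂ h₃ : ℝ}
    (d₁ : IsFlatDirection (fieldOfValues (fromBlocks B 0 0 C)) u₁ h₁)
    (d₂ : IsFlatDirection (fieldOfValues (fromBlocks B 0 0 C)) u₂ h₂)
    (d₃ : IsFlatDirection (fieldOfValues (fromBlocks B 0 0 C)) u₃ h₃)
    (h₁₂ : u₁ ≠ u₂) (h₁₃ : u₁ ≠ u₃) (h₂₃ : u₂ ≠ u₃) : False := by
  set F := fieldOfValues (fromBlocks B 0 0 C) with hF
  have hpos : ∀ u h, IsFlatDirection F u h → 0 < 2 * h := fun u h d => by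
    have := d.supportValue_pos (hB.apply_eq_zero_or hC)
    linarith
  have hB0 : ∀ u h, IsFlatDirection F u h → (kippenhahnPencil B u (2 * h)).det = 0 →
      Complex.normSq (B 0 1) = (2 * h) ^ 2 := by
    intro u h d h0
    rw [det_kippenhahnPencil_two hB d.unit] at h0
    have : (2 * h) ^ 2 - Complex.normSq (B 0 1) = 0 := by exact_mod_cast h0
    linarith
  -- a double kernel of the larger summand excludes every other flat direction
  have hsimple : ∀ u h v k, IsFlatDirection F u h → IsFlatDirection F v k → u ≠ v →
      ¬ HasDoubleKernel (kippenhahnPencil C u (2 * h)) := by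
    intro u h v k du dv huv hdk
    obtain ⟨a1, a2, a3, a4⟩ := hdk.three hC du.unit
    rcases dv.hasDoubleKernel.two_three hB (hpos _ _ dv) with hv | ⟨hv, -⟩
    · exact huv (hdk.three_unique hC du.unit dv.unit (hpos _ _ du) (hpos _ _ dv) hv)
    -- The 2 × 2 block has largest eigenvalue `2 * k` in every direction, and it is bounded by `2 *
    -- h` in direction `u`.
    have hkh : 2 * k ≤ 2 * h := by
      have h1 := hB0 _ _ dv hv
      have h2 := du.posSemidef
      rw [kippenhahnPencil_fromBlocks] at h2
      have h3 := h2.of_fromBlocks_left.det_nonneg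
      rw [det_kippenhahnPencil_two hB du.unit, Complex.zero_le_real, h1] at h3
      exact (pow_le_pow_iff_left₀ (hpos _ _ dv).le (hpos _ _ du).le two_ne_zero).1 (by linarith)
    have hpsd : (kippenhahnPencil C v (2 * h)).PosSemidef := by
      have h2 := dv.posSemidef
      rw [kippenhahnPencil_fromBlocks] at h2
      rcases hkh.eq_or_lt with h3 | h3
      · rw [← h3]
        exact h2.of_fromBlocks_right
      · exact (posDef_kippenhahnPencil_of_lt h2.of_fromBlocks_right h3).posSemidef
    have hdet := hpsd.det_nonneg
    rw [det_kippenhahnPencil_three hC dv.unit, Complex.zero_le_real, a1, a2, a3] at hdet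
    set τ := C 0 1 * C 1 2 * conj (C 0 2) with hτ
    have hN : Complex.normSq (conj v * τ) = ((2 * h) ^ 3) ^ 2 := by
      rw [normSq_conj_mul dv.unit, hτ, map_mul, map_mul, Complex.normSq_conj, a1, a2, a3]
      ring
    have hNu : Complex.normSq (conj u * τ) = ((2 * h) ^ 3) ^ 2 := by
      rw [← hN, normSq_conj_mul du.unit, normSq_conj_mul dv.unit]
    have hc3 : 0 < (2 * h) ^ 3 := pow_pos (hpos _ _ du) 3
    rw [Complex.normSq_apply] at hN hNu
    rw [a4] at hNu
    -- Nonnegativity of the 3 × 3 determinant at `2 * h` in direction `v` pushes the real part down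
    -- to minus the modulus, so `conj v * τ = conj u * τ`.
    have hvle : (conj v * τ).re ≤ -(2 * h) ^ 3 := by linarith
    have hvre : (conj v * τ).re = -(2 * h) ^ 3 := by nlinarith [mul_self_nonneg (conj v * τ).im]
    have hvim : (conj v * τ).im = 0 := by
      rw [hvre] at hN
      nlinarith
    have huim : (conj u * τ).im = 0 := by nlinarith
    have hτ0 : τ ≠ 0 := by
      intro h0
      rw [h0, mul_zero, Complex.zero_re] at hvre
      linarith
    have he : conj u * τ = conj v * τ := Complex.ext (a4.trans hvre.symm) (huim.trans hvim.symm)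
    exact huv ((starRingEnd ℂ).injective (mul_right_cancel₀ hτ0 he))
  have hE : ∀ u h v k, IsFlatDirection F u h → IsFlatDirection F v k → u ≠ v →
      Complex.normSq (B 0 1) = (2 * h) ^ 2 ∧
      (2 * h) ^ 3 - (2 * h) * (Complex.normSq (C 0 1) + Complex.normSq (C 0 2) +
        Complex.normSq (C 1 2)) - 2 * (conj u * (C 0 1 * C 1 2 * conj (C 0 2))).re = 0 := by
    intro u h v k du dv huv
    rcases du.hasDoubleKernel.two_three hB (hpos _ _ du) with hv | ⟨hv, hv'⟩
    · exact absurd hv (hsimple _ _ _ _ du dv huv)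
    refine ⟨hB0 _ _ du hv, ?_⟩
    rw [det_kippenhahnPencil_three hC du.unit] at hv'
    exact_mod_cast hv'
  obtain ⟨b1, c1⟩ := hE _ _ _ _ d₁ d₂ h₁₂
  obtain ⟨b2, c2⟩ := hE _ _ _ _ d₂ d₃ h₂₃
  obtain ⟨b3, c3⟩ := hE _ _ _ _ d₃ d₁ h₁₃.symm
  have e12 : 2 * h₂ = 2 * h₁ :=
    (pow_left_inj₀ (hpos _ _ d₂).le (hpos _ _ d₁).le two_ne_zero).1 (b2.symm.trans b1)
  have e13 : 2 * h₃ = 2 * h₁ :=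
    (pow_left_inj₀ (hpos _ _ d₃).le (hpos _ _ d₁).le two_ne_zero).1 (b3.symm.trans b1)
  rw [e12] at c2
  rw [e13] at c3
  have hτ0 := eq_zero_of_re_conj_mul_eq d₁.unit d₂.unit d₃.unit h₁₂ h₁₃ h₂₃
    (conj u₁ * (C 0 1 * C 1 2 * conj (C 0 2))).re rfl (by linarith) (by linarith)
  refine not_isFlatDirection_of_det_eq (fun v hv t => ?_) d₁
  rw [det_kippenhahnPencil_fromBlocks, det_kippenhahnPencil_fromBlocks,
    det_kippenhahnPencil_two hB hv, det_kippenhahnPencil_two hB d₁.unit,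
    det_kippenhahnPencil_three hC hv, det_kippenhahnPencil_three hC d₁.unit, hτ0]
  simp

/-! ### Reduction to triangular blocks and the upper bound -/

section

variable {k m : ℕ}

theorem isNilpotent_star_mul_mul {n : ℕ} {A : Matrix (Fin n) (Fin n) ℂ} (hA : IsNilpotent A)
    (U : unitaryGroup (Fin n) ℂ) :
    IsNilpotent (star (U : Matrix (Fin n) (Fin n) ℂ) * A * (U : Matrix (Fin n) (Fin n) ℂ)) := by
  have h2 : (U : Matrix (Fin n) (Fin n) ℂ) * star (U : Matrix (Fin n) (Fin n) ℂ) = 1 :=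
    Unitary.coe_mul_star_self U
  have h1 : star (U : Matrix (Fin n) (Fin n) ℂ) * (U : Matrix (Fin n) (Fin n) ℂ) = 1 :=
    Unitary.coe_star_mul_self U
  have key : ∀ j, (star (U : Matrix (Fin n) (Fin n) ℂ) * A * (U : Matrix (Fin n) (Fin n) ℂ)) ^ j =
      star (U : Matrix (Fin n) (Fin n) ℂ) * A ^ j * (U : Matrix (Fin n) (Fin n) ℂ) := by
    intro j
    induction j with
    | zero => rw [pow_zero, pow_zero, Matrix.mul_one, h1]
    | succ j ih =>
      rw [pow_succ, ih, pow_succ]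
      simp only [Matrix.mul_assoc]
      rw [← Matrix.mul_assoc (U : Matrix (Fin n) (Fin n) ℂ) (star _), h2, Matrix.one_mul]
  obtain ⟨j, hj⟩ := hA
  exact ⟨j, by rw [key, hj, Matrix.mul_zero, Matrix.zero_mul]⟩

theorem isNilpotent_fromBlocks_iff {B : Matrix (Fin k) (Fin k) ℂ} {C : Matrix (Fin m) (Fin m) ℂ} :
    IsNilpotent (fromBlocks B 0 0 C) ↔ IsNilpotent B ∧ IsNilpotent C := by
  constructor
  · rintro ⟨j, hj⟩
    rw [fromBlocks_diagonal_pow] at hj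
    refine ⟨⟨j, ?_⟩, ⟨j, ?_⟩⟩
    · have := congrArg toBlocks₁₁ hj
      rwa [toBlocks_fromBlocks₁₁] at this
    · have := congrArg toBlocks₂₂ hj
      rwa [toBlocks_fromBlocks₂₂] at this
  · rintro ⟨⟨i, hi⟩, ⟨j, hj⟩⟩
    refine ⟨i + j, ?_⟩
    rw [fromBlocks_diagonal_pow, pow_add, pow_add, hi, hj, Matrix.zero_mul, Matrix.mul_zero,
      fromBlocks_zero]

theorem isNilpotent_reindex_iff {ι κ : Type*} [Fintype ι] [Fintype κ] [DecidableEq ι]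
    [DecidableEq κ] (e : ι ≃ κ) {M : Matrix ι ι ℂ} :
    IsNilpotent (reindex e e M) ↔ IsNilpotent M := by
  rw [← coe_reindexAlgEquiv ℂ ℂ e]
  exact IsNilpotent.map_iff (reindexAlgEquiv ℂ ℂ e).injective

theorem IsStrictUpper.isNilpotent {n : ℕ} {M : Matrix (Fin n) (Fin n) ℂ} (hM : IsStrictUpper M) :
    IsNilpotent M := by
  have h1 : M.charpoly = Polynomial.X ^ n := by
    rw [charpoly_of_isUpperTriangular M fun i j hij => hM i j (le_of_lt hij)]
    simp [hM _ _ le_rfl]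
  have h2 := aeval_self_charpoly M
  rw [h1, map_pow, Polynomial.aeval_X] at h2
  exact ⟨n, h2⟩

theorem exists_fieldOfValues_eq_strictUpper {B : Matrix (Fin k) (Fin k) ℂ}
    {C : Matrix (Fin m) (Fin m) ℂ} (hB : IsNilpotent B) (hC : IsNilpotent C) :
    ∃ (B' : Matrix (Fin k) (Fin k) ℂ) (C' : Matrix (Fin m) (Fin m) ℂ),
      IsStrictUpper B' ∧ IsStrictUpper C' ∧
      fieldOfValues (fromBlocks B 0 0 C) = fieldOfValues (fromBlocks B' 0 0 C') := by
  obtain ⟨U, hU⟩ := exists_unitary_conj_strictUpper hB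
  obtain ⟨V, hV⟩ := exists_unitary_conj_strictUpper hC
  refine ⟨_, _, hU, hV, ?_⟩
  have hst : star (fromBlocks (U : Matrix (Fin k) (Fin k) ℂ) 0 0 (V : Matrix (Fin m) (Fin m) ℂ)) =
      fromBlocks (star (U : Matrix (Fin k) (Fin k) ℂ)) 0 0 (star (V : Matrix (Fin m) (Fin m) ℂ)) := by
    simp [star_eq_conjTranspose, fromBlocks_conjTranspose]
  have hW : fromBlocks (U : Matrix (Fin k) (Fin k) ℂ) 0 0 (V : Matrix (Fin m) (Fin m) ℂ) ∈
      unitaryGroup (Fin k ⊕ Fin m) ℂ := by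
    rw [mem_unitaryGroup_iff, hst, fromBlocks_multiply]
    simp
  rw [← fieldOfValues_unitary_conj _ ⟨_, hW⟩]
  simp only [hst, fromBlocks_multiply]
  simp

theorem fieldOfValues_fromBlocks_comm (B : Matrix (Fin k) (Fin k) ℂ) (C : Matrix (Fin m) (Fin m) ℂ) :
    fieldOfValues (fromBlocks B 0 0 C) = fieldOfValues (fromBlocks C 0 0 B) := by
  rw [← fieldOfValues_reindex (Equiv.sumComm (Fin k) (Fin m))]
  congr 1
  ext (i | i) (j | j) <;> rfl

theorem fieldOfValues_right_subset (B : Matrix (Fin k) (Fin k) ℂ) (C : Matrix (Fin m) (Fin m) ℂ) :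
    fieldOfValues C ⊆ fieldOfValues (fromBlocks B 0 0 C) := by
  rintro z ⟨x, hx, rfl⟩
  refine ⟨Sum.elim 0 x, ?_, ?_⟩
  · rw [← hx]
    simp [dotProduct]
  · rw [fromBlocks_mulVec]
    simp [dotProduct]

theorem Matrix.PosSemidef.fromBlocks_diagonal {B : Matrix (Fin k) (Fin k) ℂ}
    {C : Matrix (Fin m) (Fin m) ℂ} (hB : B.PosSemidef) (hC : C.PosSemidef) :
    (fromBlocks B 0 0 C).PosSemidef := by
  refine PosSemidef.of_dotProduct_mulVec_nonneg ?_ fun x => ?_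
  · rw [IsHermitian, fromBlocks_conjTranspose, hB.isHermitian.eq, hC.isHermitian.eq]
    simp
  · rw [fromBlocks_mulVec]
    have h1 := hB.dotProduct_mulVec_nonneg (x ∘ Sum.inl)
    have h2 := hC.dotProduct_mulVec_nonneg (x ∘ Sum.inr)
    have h3 := add_nonneg h1 h2
    simpa [dotProduct] using h3

theorem numericalRange_reindex (e : Fin k ⊕ Fin m ≃ Fin 5) (B : Matrix (Fin k) (Fin k) ℂ)
    (C : Matrix (Fin m) (Fin m) ℂ) :
    numericalRange (reindex e e (fromBlocks B 0 0 C)) = fieldOfValues (fromBlocks B 0 0 C) := by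
  rw [numericalRange_eq_fieldOfValues, fieldOfValues_reindex]

theorem isUnitarilyReducible_reindex {n : ℕ} (hk : 0 < k) (hm : 0 < m) (e : Fin k ⊕ Fin m ≃ Fin n)
    (B : Matrix (Fin k) (Fin k) ℂ) (C : Matrix (Fin m) (Fin m) ℂ) :
    IsUnitarilyReducible (reindex e e (fromBlocks B 0 0 C)) :=
  ⟨k, m, e, 1, B, C, hk, hm, by simp⟩

theorem encard_flatPortions_numericalRange_le_two {A : Matrix (Fin 5) (Fin 5) ℂ}
    (hA : IsNilpotent A) (hred : IsUnitarilyReducible A) :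
    (flatPortions (numericalRange A)).encard ≤ 2 := by
  obtain ⟨k, m, e, U, B, C, hk, hm, hU⟩ := hred
  have hkm : k + m = 5 := by simpa using Fintype.card_congr e
  have hnil := isNilpotent_star_mul_mul hA U
  rw [hU, isNilpotent_reindex_iff, isNilpotent_fromBlocks_iff] at hnil
  obtain ⟨B', C', hB', hC', hBC⟩ := exists_fieldOfValues_eq_strictUpper hnil.1 hnil.2
  have hF : numericalRange A = fieldOfValues (fromBlocks B' 0 0 C') := by
    rw [numericalRange_eq_fieldOfValues, ← fieldOfValues_unitary_conj A U, hU,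
      fieldOfValues_reindex, hBC]
  rw [hF]
  clear hF hBC hnil hU e hA
  wlog hle : k ≤ m generalizing k m
  · rw [fieldOfValues_fromBlocks_comm]
    exact this m k C B hm hk (by omega) C' B' hC' hB' (by omega)
  refine encard_flatPortions_le_two (isCompact_fieldOfValues _) (convex_fieldOfValues _) ?_
  intro u₁ u₂ u₃ h₁ h₂ h₃ d₁ d₂ d₃ h₁₂ h₁₃ h₂₃
  obtain ⟨rfl, rfl⟩ | ⟨rfl, rfl⟩ : k = 1 ∧ m = 4 ∨ k = 2 ∧ m = 3 := by omega
  · exact not_three_flatDirections_one_four hB' hC' d₁ d₂ d₃ h₁₂ h₁₃ h₂₃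
  · exact not_three_flatDirections_two_three hB' hC' d₁ d₂ d₃ h₁₂ h₁₃ h₂₃

end

/-! ### Matrices with exactly zero, one and two flat portions -/

/-- The `5 × 5` matrix `E₁₂`, whose numerical range is a disc, has no flat portion. -/
theorem exists_encard_flatPortions_eq_zero : ∃ A : Matrix (Fin 5) (Fin 5) ℂ, IsNilpotent A ∧
    IsUnitarilyReducible A ∧ (flatPortions (numericalRange A)).encard = 0 := by
  set B : Matrix (Fin 2) (Fin 2) ℂ := !![0, 1; 0, 0] with hBdef
  have hB : IsStrictUpper B := by
    intro i j hij
    fin_cases i <;> fin_cases j <;> simp_all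
  have hC : IsStrictUpper (0 : Matrix (Fin 3) (Fin 3) ℂ) := fun _ _ _ => rfl
  let e : Fin 2 ⊕ Fin 3 ≃ Fin 5 := finSumFinEquiv
  refine ⟨reindex e e (fromBlocks B 0 0 0), ?_,
    isUnitarilyReducible_reindex (by norm_num) (by norm_num) e B 0, ?_⟩
  · rw [isNilpotent_reindex_iff, isNilpotent_fromBlocks_iff]
    exact ⟨hB.isNilpotent, hC.isNilpotent⟩
  rw [numericalRange_reindex, Set.encard_eq_zero, Set.eq_empty_iff_forall_notMem]
  intro S hS
  obtain ⟨u, h, d, -⟩ := exists_isFlatDirection_of_mem_flatPortions (isCompact_fieldOfValues _)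
    (convex_fieldOfValues _) hS
  refine not_isFlatDirection_of_det_eq (fun v hv t => ?_) d
  rw [det_kippenhahnPencil_fromBlocks, det_kippenhahnPencil_fromBlocks,
    det_kippenhahnPencil_two hB hv, det_kippenhahnPencil_two hB d.unit,
    det_kippenhahnPencil_three hC hv, det_kippenhahnPencil_three hC d.unit]
  simp

/-- In direction `-1` at `t = 1` the pencil of `C` is the all-ones matrix, of rank one, so its
kernel is a plane. The other block is zero, so every flat direction needs a double kernel of `C`,
and `HasDoubleKernel.three_unique` leaves one. -/
theorem exists_encard_flatPortions_eq_one : ∃ A : Matrix (Fin 5) (Fin 5) ℂ, IsNilpotent A ∧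
    IsUnitarilyReducible A ∧ (flatPortions (numericalRange A)).encard = 1 := by
  set C : Matrix (Fin 3) (Fin 3) ℂ := !![0, 1, 1; 0, 0, 1; 0, 0, 0] with hCdef
  have hC : IsStrictUpper C := by
    intro i j hij
    fin_cases i <;> fin_cases j <;> simp_all
  have hB : IsStrictUpper (0 : Matrix (Fin 2) (Fin 2) ℂ) := fun _ _ _ => rfl
  let e : Fin 2 ⊕ Fin 3 ≃ Fin 5 := finSumFinEquiv
  refine ⟨reindex e e (fromBlocks 0 0 0 C), ?_,
    isUnitarilyReducible_reindex (by norm_num) (by norm_num) e 0 C, ?_⟩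
  · rw [isNilpotent_reindex_iff, isNilpotent_fromBlocks_iff]
    exact ⟨hB.isNilpotent, hC.isNilpotent⟩
  rw [numericalRange_reindex]
  set F := fieldOfValues (fromBlocks (0 : Matrix (Fin 2) (Fin 2) ℂ) 0 0 C) with hF
  have d : IsFlatDirection F (-1) (1 / 2) := by
    refine ⟨by simp, ?_, ?_⟩
    · rw [hF, ← posSemidef_kippenhahnPencil_iff, kippenhahnPencil_fromBlocks]
      refine PosSemidef.fromBlocks_diagonal ?_ ?_
      · have : kippenhahnPencil (0 : Matrix (Fin 2) (Fin 2) ℂ) (-1) (2 * (1 / 2)) = 1 := by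
          simp [kippenhahnPencil]
        rw [this]
        exact PosSemidef.one
      · have : kippenhahnPencil C (-1) (2 * (1 / 2)) =
            vecMulVec (fun _ => (1 : ℂ)) (star fun _ => (1 : ℂ)) := by
          ext i j
          fin_cases i <;> fin_cases j <;>
            simp [kippenhahnPencil_apply, hCdef, vecMulVec_apply]
        rw [this]
        exact posSemidef_vecMulVec_self_star _
    -- Both test vectors have coordinate sum zero, so they lie in the kernel of the all-ones matrix.
    · have h1 : (-(1 / 2) : ℂ) ∈ fieldOfValues C := by
        convert div_mem_fieldOfValues C (x := ![1, -1, 0])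
          (fun h => one_ne_zero (congrFun h 0)) using 1
        simp [hCdef, dotProduct, mulVec, Fin.sum_univ_three]
        norm_num
      have h2 : (-(1 / 2) + Complex.I / 4 : ℂ) ∈ fieldOfValues C := by
        convert div_mem_fieldOfValues C (x := ![1, Complex.I, -1 - Complex.I])
          (fun h => one_ne_zero (congrFun h 0)) using 1
        simp [hCdef, dotProduct, mulVec, Fin.sum_univ_three]
        ring_nf
        norm_num
        ring
      refine ⟨_, fieldOfValues_right_subset 0 C h1, _, fieldOfValues_right_subset 0 C h2, ?_, ?_, ?_⟩
      · intro h
        have := congrArg Complex.im h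
        norm_num at this
      · norm_num
      · norm_num
  have hpos : ∀ u h, IsFlatDirection F u h → 0 < 2 * h := fun u h d => by
    have := d.supportValue_pos (hB.apply_eq_zero_or hC)
    linarith
  have hdk : ∀ u h, IsFlatDirection F u h → HasDoubleKernel (kippenhahnPencil C u (2 * h)) := by
    intro u h du
    refine (du.hasDoubleKernel.two_three hB (hpos u h du)).resolve_right fun h0 => ?_
    have h1 := h0.1
    rw [det_kippenhahnPencil_two hB du.unit] at h1
    have h2 := hpos u h du
    simp at h1
    linarith
  rw [Set.encard_eq_one]
  refine ⟨supportFace F (-1) (1 / 2), Set.Subset.antisymm ?_ ?_⟩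
  · intro S hS
    obtain ⟨u, h, du, rfl⟩ := exists_isFlatDirection_of_mem_flatPortions
      (isCompact_fieldOfValues _) (convex_fieldOfValues _) hS
    have hu : u = -1 := (hdk u h du).three_unique hC du.unit d.unit (hpos _ _ du) (hpos _ _ d)
      (hdk _ _ d)
    subst hu
    rw [du.supportValue_unique d]
    rfl
  · rintro S rfl
    exact d.supportFace_mem_flatPortions (isCompact_fieldOfValues _) (convex_fieldOfValues _)

/-- The entries 3, 4, 4, 3 make the Hermitian matrix `H = conj u • C + u • Cᴴ` satisfy `H² = 25` for
`u = ±I`, so both horizontal supporting lines have double eigenvalue 5. The upper bound gives the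
rest. -/
theorem exists_encard_flatPortions_eq_two : ∃ A : Matrix (Fin 5) (Fin 5) ℂ, IsNilpotent A ∧
    IsUnitarilyReducible A ∧ (flatPortions (numericalRange A)).encard = 2 := by
  set C : Matrix (Fin 4) (Fin 4) ℂ := !![0, 3, 0, 4; 0, 0, 4, 0; 0, 0, 0, 3; 0, 0, 0, 0] with hCdef
  have hC : IsStrictUpper C := by
    intro i j hij
    fin_cases i <;> fin_cases j <;> simp_all
  have hB : IsStrictUpper (0 : Matrix (Fin 1) (Fin 1) ℂ) := fun _ _ _ => rfl
  let e : Fin 1 ⊕ Fin 4 ≃ Fin 5 := finSumFinEquiv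
  have hnil : IsNilpotent (reindex e e (fromBlocks 0 0 0 C)) := by
    rw [isNilpotent_reindex_iff, isNilpotent_fromBlocks_iff]
    exact ⟨hB.isNilpotent, hC.isNilpotent⟩
  have hred := isUnitarilyReducible_reindex one_pos four_pos e 0 C
  refine ⟨reindex e e (fromBlocks 0 0 0 C), hnil, hred,
    (encard_flatPortions_numericalRange_le_two hnil hred).antisymm ?_⟩
  rw [numericalRange_reindex]
  set F := fieldOfValues (fromBlocks (0 : Matrix (Fin 1) (Fin 1) ℂ) 0 0 C) with hF
  have hle : ∀ u : ℂ, u = Complex.I ∨ u = -Complex.I → ∀ z ∈ F, (conj u * z).re ≤ 5 / 2 := by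
    intro u hu
    rw [hF, ← posSemidef_kippenhahnPencil_iff, kippenhahnPencil_fromBlocks]
    refine PosSemidef.fromBlocks_diagonal ?_ ?_
    · have : kippenhahnPencil (0 : Matrix (Fin 1) (Fin 1) ℂ) u (2 * (5 / 2)) = ((5 : ℝ) : ℂ) • 1 := by
        simp [kippenhahnPencil]
        norm_num
      rw [this]
      exact PosSemidef.one.smul (by rw [Complex.zero_le_real]; norm_num)
    -- With `K = 5 - H` and `H² = 25` one has `K² = 10 K`, which exhibits `K` as a positive multiple
    -- of `Kᴴ * K`.
    · have hsq : kippenhahnPencil C u (2 * (5 / 2)) = (((1 / 10 : ℝ)) : ℂ) •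
          ((kippenhahnPencil C u (2 * (5 / 2)))ᴴ * kippenhahnPencil C u (2 * (5 / 2))) := by
        rw [(isHermitian_kippenhahnPencil C u _).eq]
        ext i j
        rw [Matrix.smul_apply, mul_apply, Fin.sum_univ_four]
        simp only [kippenhahnPencil_apply]
        rcases hu with rfl | rfl <;> fin_cases i <;> fin_cases j <;>
          simp [hCdef, Complex.conj_ofNat] <;> ring_nf <;> simp <;> norm_num
      rw [hsq]
      exact (posSemidef_conjTranspose_mul_self _).smul (by rw [Complex.zero_le_real]; norm_num)
  -- The sign `t` selects the horizontal supporting line and `s` one of two points on it; the test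
  -- vector has squared norm 100.
  have hmem : ∀ s t : ℝ, s ^ 2 = 1 → t ^ 2 = 1 → (((6 / 5 * s : ℝ) : ℂ) + (5 / 2 * t : ℝ) * Complex.I) ∈ F := by
    intro s t hs ht
    apply fieldOfValues_right_subset 0 C
    have hs' : (s : ℂ) ^ 2 = 1 := by exact_mod_cast hs
    have ht' : (t : ℂ) ^ 2 = 1 := by exact_mod_cast ht
    convert div_mem_fieldOfValues C
      (x := ![5, 4 * s + 3 * t * Complex.I, 5 * s * t * Complex.I, -3 * s + 4 * t * Complex.I])
      (fun h => by simpa using congrFun h 0) using 1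
    simp [hCdef, dotProduct, mulVec, Fin.sum_univ_four, Complex.conj_ofNat]
    have hden : (5 * 5 + (4 * (s : ℂ) + -(3 * t * Complex.I)) * (4 * s + 3 * t * Complex.I) +
        -(5 * s * t * Complex.I * (5 * s * t * Complex.I)) +
        (-(3 * s) + -(4 * t * Complex.I)) * (-(3 * s) + 4 * t * Complex.I)) = 100 := by
      linear_combination (25 + 25 * (t : ℂ) ^ 2) * hs' + 50 * ht'
        - 25 * ((t : ℂ) ^ 2 + s ^ 2 * t ^ 2) * Complex.I_sq
    rw [hden, eq_div_iff (by norm_num)]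
    linear_combination -(125 * t * Complex.I) * hs' + 120 * s * t ^ 2 * Complex.I_sq
      - 120 * s * ht'
  have d1 : IsFlatDirection F Complex.I (5 / 2) := by
    refine ⟨by simp, hle _ (Or.inl rfl), _, hmem 1 1 (by norm_num) (by norm_num), _,
      hmem (-1) 1 (by norm_num) (by norm_num), fun h => ?_, by norm_num, by norm_num⟩
    have := congrArg Complex.re h
    norm_num at this
  have d2 : IsFlatDirection F (-Complex.I) (5 / 2) := by
    refine ⟨by simp, hle _ (Or.inr rfl), _, hmem 1 (-1) (by norm_num) (by norm_num), _,
      hmem (-1) (-1) (by norm_num) (by norm_num), fun h => ?_, by norm_num, by norm_num⟩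
    have := congrArg Complex.re h
    norm_num at this
  have hne : supportFace F Complex.I (5 / 2) ≠ supportFace F (-Complex.I) (5 / 2) := by
    intro h
    obtain ⟨a, ha, -, -, -, hah, -⟩ := d1.nondeg
    have h1 : a ∈ supportFace F (-Complex.I) (5 / 2) := h ▸ ⟨ha, hah⟩
    have h2 := h1.2
    rw [map_neg, neg_mul, Complex.neg_re, hah] at h2
    norm_num at h2
  rw [← Set.encard_pair hne]
  refine Set.encard_le_encard ?_
  rintro S (rfl | rfl)
  · exact d1.supportFace_mem_flatPortions (isCompact_fieldOfValues _) (convex_fieldOfValues _)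
  · exact d2.supportFace_mem_flatPortions (isCompact_fieldOfValues _) (convex_fieldOfValues _)

end

theorem theorem6p1 :
    (∀ A : Matrix (Fin 5) (Fin 5) ℂ, IsNilpotent A → IsUnitarilyReducible A →
      (flatPortions (numericalRange A)).encard ≤ 2) ∧
    (∀ N : ℕ, N ≤ 2 → ∃ A : Matrix (Fin 5) (Fin 5) ℂ, IsNilpotent A ∧ IsUnitarilyReducible A ∧
      (flatPortions (numericalRange A)).encard = (N : ℕ∞)) := by
  refine ⟨fun A hA hred => encard_flatPortions_numericalRange_le_two hA hred, fun N hN => ?_⟩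
  interval_cases N
  · exact exists_encard_flatPortions_eq_zero
  · exact exists_encard_flatPortions_eq_one
  · exact exists_encard_flatPortions_eq_two
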